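/- Let $\mathscr{C}$ be a Krull--Schmidt extriangulated category (in the sense of Nakaoka--Palu, with additive bifunctor $\mathbb{E}$) that has enough projectives and enough injectives and satisfies the condition (WIC): if $gf$ is an inflation, so is $f$; if $gf$ is a deflation, so is $g$. "Subcategory" means full additive subcategory closed under isomorphisms and direct summands, and $\mathbb{E}^{i+1}(X,Y)=\mathbb{E}(\Omega^{i}X,Y)$ for $i\ge 0$, where $\Omega$ denotes a syzygy. For a class $\omega$ of objects let $\omega^{\perp}$ be the class of objects $Y$ with $\mathbb{E}^i(X,Y)=0$ for all $i\ge1$ and $X\in\omega$; a subcategory $\omega$ is self-orthogonal if $\omega\subseteq\omega^\perp$. Let $\hat\omega$ (resp. $\check\omega$) be the class of objects $A$ that admit, for some $n\ge 0$, a finite $\mathbb{E}$-triangle sequence $W_n\to\cdots\to W_0\to A$ (resp. $A\to W^0\to\cdots\to W^n$) with all terms $W_i$ (resp. $W^i$) in $\omega$. For $\omega$ self-orthogonal let ${}_\omega\mathcal{X}$ be the class of objects $A$ that admit conflations $K_{i+1}\to W_i\to K_i$ $(i\ge 0)$ with $K_0=A$, $W_i\in\omega$ and $K_i\in\omega^\perp$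 for all $i$. A subcategory $\mathcal{T}$ is $\mathcal{C}$-tilting if $\mathcal{C}$ and $\mathcal{T}$ are self-orthogonal, $\mathcal{T}\subseteq\hat{\mathcal{C}}$ and $\mathcal{C}\subseteq\check{\mathcal{T}}$; it is finite if $\mathcal{T}=\mathrm{add}\,T$ for some object $T$. Let $\mathcal{C}$ be a self-orthogonal subcategory of $\mathscr{C}$ and put $\mathcal{Y}={}_{\mathcal{C}}\mathcal{X}$. Assume: (a) $\mathcal{Y}$ has a relative injective cogenerator, i.e. there is a subcategory $\mathcal{I}\subseteq\mathcal{Y}\cap\mathcal{Y}^\perp$ such that every $Y\in\mathcal{Y}$ has a conflation $Y\to I\to Y'$ with $I\in\mathcal{I}$ and $Y'\in\mathcal{Y}$; (b) $\check{\mathcal{Y}}$ is finitely filtered, i.e. there is a finite set $\mathcal{S}$ of objects of $\check{\mathcal{Y}}$ such that every $M\in\check{\mathcal{Y}}$ has a finite chain $0=M_0\to M_1\to\cdots\to M_n=M$ with conflations $M_{i-1}\to M_i\to S_i$, $S_i\in\mathcal{S}$. Then $\mathcal{T}\mapsto\check{\mathcal{T}}\cap{}_{\mathcal{C}}\mathcal{X}$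 is a bijection from the finite $\mathcal{C}$-tilting subcategories onto the subcategories $\mathcal{D}$ of $\mathscr{C}$ such that (i) $\mathcal{D}$ is a relative resolving subcategory of ${}_{\mathcal{C}}\mathcal{X}$: $\mathcal{D}\subseteq{}_{\mathcal{C}}\mathcal{X}$, $\mathcal{D}$ is closed under direct summands, under extensions and under cocones of deflations with respect to the conflations whose three terms lie in ${}_{\mathcal{C}}\mathcal{X}$, and $\mathcal{D}$ contains the projective objects of ${}_{\mathcal{C}}\mathcal{X}$; (ii) $\mathcal{D}$ is strongly contravariantly finite in ${}_{\mathcal{C}}\mathcal{X}$: every $X\in{}_{\mathcal{C}}\mathcal{X}$ has a conflation $K\to W\xrightarrow{g}X$ in ${}_{\mathcal{C}}\mathcal{X}$ with $g$ a right $\mathcal{D}$-approximation of $X$; (iii) $\mathcal{D}\subseteq\hat{\mathcal{C}}$. -/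

import Mathlib

open CategoryTheory CategoryTheory.Limits Opposite

universe w v u

attribute [local instance] hasBinaryBiproducts_of_finite_biproducts

namespace Extri

/-- For a bifunctor `E : Cᵒᵖ ⥤ C ⥤ Ab`, the abelian group `E(X, A)` of extensions of `X` by `A`. -/
abbrev Extn {C : Type u} [Category.{v} C] (E : Cᵒᵖ ⥤ C ⥤ AddCommGrpCat.{w}) (X A : C) : Type w :=
  (E.obj (op X)).obj A

/-- `a_* δ` -/
def push {C : Type u} [Category.{v} C] (E : Cᵒᵖ ⥤ C ⥤ AddCommGrpCat.{w}) {X A A' : C}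
    (a : A ⟶ A') (δ : Extn E X A) : Extn E X A' :=
  ((E.obj (op X)).map a).hom δ

/-- `c^* δ` -/
def pull {C : Type u} [Category.{v} C] (E : Cᵒᵖ ⥤ C ⥤ AddCommGrpCat.{w}) {X X' A : C}
    (c : X' ⟶ X) (δ : Extn E X A) : Extn E X' A :=
  ((E.map c.op).app A).hom δ

/-- The direct sum `δ ⊕ δ' ∈ E(X ⊕ X', A ⊕ A')` of two extensions: the element with components
`δ, 0, 0, δ'` under the decomposition given by biadditivity. -/
noncomputable def extnSum {C : Type u} [Category.{v} C] [Preadditive C] [HasFiniteBiproducts C]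
    (E : Cᵒᵖ ⥤ C ⥤ AddCommGrpCat.{w}) {X A X' A' : C}
    (δ : Extn E X A) (δ' : Extn E X' A') : Extn E (X ⊞ X') (A ⊞ A') :=
  pull E biprod.fst (push E biprod.inl δ) + pull E biprod.snd (push E biprod.inr δ')

/-- An extriangulated structure on an additive category `C` (Nakaoka--Palu). The realization `s`
is encoded by the relation `Realizes x y δ`, meaning `s(δ) = [A --x--> B --y--> X]`: by
`exists_realizes` and `realizes_iff`, the sequences realizing `δ` form exactly one equivalence
class. -/
structure ExtriangulatedStructure (C : Type u) [Category.{v} C] [Preadditive C]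
    [HasFiniteBiproducts C] where
  /-- (ET1) -/
  E : Cᵒᵖ ⥤ C ⥤ AddCommGrpCat.{w}
  additive_left : E.Additive
  additive_right : ∀ X : Cᵒᵖ, (E.obj X).Additive
  /-- (ET2): an additive realization -/
  Realizes : ∀ {A B X : C}, (A ⟶ B) → (B ⟶ X) → Extn E X A → Prop
  exists_realizes : ∀ {A X : C} (δ : Extn E X A),
    ∃ (B : C) (x : A ⟶ B) (y : B ⟶ X), Realizes x y δ
  realizes_iff : ∀ {A B B' X : C} {x : A ⟶ B} {y : B ⟶ X} {δ : Extn E X A}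
    (x' : A ⟶ B') (y' : B' ⟶ X), Realizes x y δ →
      (Realizes x' y' δ ↔ ∃ b : B ≅ B', x ≫ b.hom = x' ∧ b.hom ≫ y' = y)
  exists_realizes_morphism : ∀ {A B X A' B' X' : C} {x : A ⟶ B} {y : B ⟶ X} {δ : Extn E X A}
    {x' : A' ⟶ B'} {y' : B' ⟶ X'} {δ' : Extn E X' A'},
    Realizes x y δ → Realizes x' y' δ' → ∀ (a : A ⟶ A') (c : X ⟶ X'), push E a δ = pull E c δ' →
      ∃ b : B ⟶ B', x ≫ b = a ≫ x' ∧ y ≫ c = b ≫ y'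
  realizes_zero : ∀ A X : C,
    Realizes (biprod.inl : A ⟶ A ⊞ X) (biprod.snd : A ⊞ X ⟶ X) (0 : Extn E X A)
  realizes_sum : ∀ {A B X A' B' X' : C} {x : A ⟶ B} {y : B ⟶ X} {δ : Extn E X A}
    {x' : A' ⟶ B'} {y' : B' ⟶ X'} {δ' : Extn E X' A'},
    Realizes x y δ → Realizes x' y' δ' →
      Realizes (biprod.map x x') (biprod.map y y') (extnSum E δ δ')
  /-- (ET3) -/
  et3 : ∀ {A B X A' B' X' : C} {x : A ⟶ B} {y : B ⟶ X} {δ : Extn E X A}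
    {x' : A' ⟶ B'} {y' : B' ⟶ X'} {δ' : Extn E X' A'},
    Realizes x y δ → Realizes x' y' δ' → ∀ (a : A ⟶ A') (b : B ⟶ B'), x ≫ b = a ≫ x' →
      ∃ c : X ⟶ X', y ≫ c = b ≫ y' ∧ push E a δ = pull E c δ'
  /-- (ET3)ᵒᵖ -/
  et3_op : ∀ {A B X A' B' X' : C} {x : A ⟶ B} {y : B ⟶ X} {δ : Extn E X A}
    {x' : A' ⟶ B'} {y' : B' ⟶ X'} {δ' : Extn E X' A'},
    Realizes x y δ → Realizes x' y' δ' → ∀ (b : B ⟶ B') (c : X ⟶ X'), y ≫ c = b ≫ y' →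
      ∃ a : A ⟶ A', x ≫ b = a ≫ x' ∧ push E a δ = pull E c δ'
  /-- (ET4) -/
  et4 : ∀ {A B D G F : C} {f : A ⟶ B} {f' : B ⟶ D} {δ : Extn E D A}
    {g : B ⟶ G} {g' : G ⟶ F} {δ' : Extn E F B},
    Realizes f f' δ → Realizes g g' δ' →
      ∃ (Z : C) (h' : G ⟶ Z) (d : D ⟶ Z) (e : Z ⟶ F) (δ'' : Extn E Z A),
        f' ≫ d = g ≫ h' ∧ h' ≫ e = g' ∧
        Realizes (f ≫ g) h' δ'' ∧
        Realizes d e (push E f' δ') ∧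
        pull E d δ'' = δ ∧
        push E f δ'' = pull E e δ'
  /-- (ET4)ᵒᵖ -/
  et4_op : ∀ {D A B F G : C} {f' : D ⟶ A} {f : A ⟶ B} {δ : Extn E B D}
    {g' : F ⟶ B} {g : B ⟶ G} {δ' : Extn E G F},
    Realizes f' f δ → Realizes g' g δ' →
      ∃ (Z : C) (h' : Z ⟶ A) (d : D ⟶ Z) (e : Z ⟶ F) (δ'' : Extn E G Z),
        h' ≫ f = e ≫ g' ∧ d ≫ h' = f' ∧
        Realizes h' (f ≫ g) δ'' ∧
        Realizes d e (pull E g' δ) ∧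
        push E e δ'' = δ' ∧
        pull E g δ'' = push E d δ

section Additive

variable {C : Type u} [Category.{v} C] [Preadditive C] [HasFiniteBiproducts C]

/-- Every object is a finite direct sum of objects with local endomorphism rings. -/
def IsKrullSchmidt (C : Type u) [Category.{v} C] [Preadditive C] [HasFiniteBiproducts C] : Prop :=
  ∀ X : C, ∃ (n : ℕ) (f : Fin n → C), (∀ i, IsLocalRing (End (f i))) ∧ Nonempty (X ≅ ⨁ f)

/-- `ω` is (the class of objects of) a full additive subcategory closed under isomorphisms and
direct summands. -/
structure IsSubcategory (ω : ObjectProperty C) : Prop where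
  zero : ∀ Z : C, IsZero Z → ω Z
  iso : ∀ {X Y : C}, (X ≅ Y) → ω X → ω Y
  sum : ∀ {X Y : C}, ω X → ω Y → ω (X ⊞ Y)
  summand : ∀ {X Y : C}, ω (X ⊞ Y) → ω X

/-- `add T`: direct summands of finite direct sums of copies of `T`. -/
def add (T : C) : ObjectProperty C := fun X =>
  ∃ (n : ℕ) (Y : C), Nonempty (X ⊞ Y ≅ ⨁ (fun _ : Fin n => T))

/-- `ω = add T` for some object `T`. -/
def IsFiniteSubcategory (ω : ObjectProperty C) : Prop := ∃ T : C, ω = add T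

/-- `g : W ⟶ X` is a right `ω`-approximation of `X`. -/
def IsRightApprox (ω : ObjectProperty C) {W X : C} (g : W ⟶ X) : Prop :=
  ω W ∧ ∀ (W' : C) (g' : W' ⟶ X), ω W' → ∃ t : W' ⟶ W, t ≫ g = g'

end Additive

namespace ExtriangulatedStructure

variable {C : Type u} [Category.{v} C] [Preadditive C] [HasFiniteBiproducts C]
variable (ℰ : ExtriangulatedStructure.{w} C)

/-- `A --x--> B --y--> X` is a conflation. -/
def IsConflation {A B X : C} (x : A ⟶ B) (y : B ⟶ X) : Prop :=
  ∃ δ : Extn ℰ.E X A, ℰ.Realizes x y δ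

def IsInflation {A B : C} (x : A ⟶ B) : Prop := ∃ (X : C) (y : B ⟶ X), ℰ.IsConflation x y

def IsDeflation {B X : C} (y : B ⟶ X) : Prop := ∃ (A : C) (x : A ⟶ B), ℰ.IsConflation x y

/-- A conflation in the subcategory `𝒴`: all three terms lie in `𝒴`. -/
def IsConflationIn (𝒴 : ObjectProperty C) {A B X : C} (x : A ⟶ B) (y : B ⟶ X) : Prop :=
  𝒴 A ∧ 𝒴 B ∧ 𝒴 X ∧ ℰ.IsConflation x y

/-- The condition (WIC). -/
structure WIC : Prop where
  inflation : ∀ {A B X : C} (f : A ⟶ B) (g : B ⟶ X), ℰ.IsInflation (f ≫ g) → ℰ.IsInflation f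
  deflation : ∀ {A B X : C} (f : A ⟶ B) (g : B ⟶ X), ℰ.IsDeflation (f ≫ g) → ℰ.IsDeflation g

/-- `Proj(𝒴)`: the projective objects of the subcategory `𝒴`. -/
def projIn (𝒴 : ObjectProperty C) : ObjectProperty C := fun P =>
  𝒴 P ∧ ∀ {A B X : C} (x : A ⟶ B) (y : B ⟶ X), ℰ.IsConflationIn 𝒴 x y →
    ∀ c : P ⟶ X, ∃ b : P ⟶ B, b ≫ y = c

/-- `Proj(C)` -/
def proj : ObjectProperty C := ℰ.projIn ⊤

/-- `Inj(C)` -/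
def inj : ObjectProperty C := fun I =>
  ∀ {A B X : C} (x : A ⟶ B) (y : B ⟶ X), ℰ.IsConflation x y →
    ∀ a : A ⟶ I, ∃ b : B ⟶ I, x ≫ b = a

class EnoughProj : Prop where
  exists_conflation : ∀ X : C, ∃ (K P : C) (x : K ⟶ P) (y : P ⟶ X),
    ℰ.proj P ∧ ℰ.IsConflation x y

class EnoughInj : Prop where
  exists_conflation : ∀ X : C, ∃ (I L : C) (x : X ⟶ I) (y : I ⟶ L),
    ℰ.inj I ∧ ℰ.IsConflation x y

/-- A (chosen) syzygy `Ω X`. -/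
noncomputable def syzygy [ℰ.EnoughProj] (X : C) : C :=
  (EnoughProj.exists_conflation (ℰ := ℰ) X).choose

/-- `Ωⁱ X` -/
noncomputable def iterSyzygy [ℰ.EnoughProj] : ℕ → C → C
  | 0, X => X
  | i + 1, X => ℰ.syzygy (iterSyzygy i X)

/-- The higher extension group `Eⁱ⁺¹(X, Y) = E(Ωⁱ X, Y)`, for `i ≥ 0`. -/
abbrev HigherExtSucc [ℰ.EnoughProj] (i : ℕ) (X Y : C) : Type w :=
  Extn ℰ.E (ℰ.iterSyzygy i X) Y

/-- `ω^⊥`: the objects `Y` with `Eⁱ(X, Y) = 0` for all `i ≥ 1` and all `X ∈ ω`. -/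
def rightPerp [ℰ.EnoughProj] (ω : ObjectProperty C) : ObjectProperty C := fun Y =>
  ∀ X : C, ω X → ∀ (i : ℕ) (e : ℰ.HigherExtSucc i X Y), e = 0

def SelfOrthogonal [ℰ.EnoughProj] (ω : ObjectProperty C) : Prop := ω ≤ ℰ.rightPerp ω

/-- `hatN ω n`: the objects `A` with an `E`-triangle sequence `Wₙ → ⋯ → W₁ → W₀ → A`, `Wᵢ ∈ ω`. -/
def hatN (ω : ObjectProperty C) : ℕ → ObjectProperty C
  | 0 => ω
  | n + 1 => fun A => ∃ (K W : C) (g : K ⟶ W) (f : W ⟶ A),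
      hatN ω n K ∧ ω W ∧ ℰ.IsConflation g f

/-- `checkN ω n`: the objects `A` with an `E`-triangle sequence `A → W⁰ → W¹ → ⋯ → Wⁿ`,
`Wⁱ ∈ ω`. -/
def checkN (ω : ObjectProperty C) : ℕ → ObjectProperty C
  | 0 => ω
  | n + 1 => fun A => ∃ (W K : C) (g : A ⟶ W) (f : W ⟶ K),
      ω W ∧ checkN ω n K ∧ ℰ.IsConflation g f

/-- `ω̂` -/
def hat (ω : ObjectProperty C) : ObjectProperty C := fun A => ∃ n : ℕ, ℰ.hatN ω n A

/-- `ω̌` -/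
def check (ω : ObjectProperty C) : ObjectProperty C := fun A => ∃ n : ℕ, ℰ.checkN ω n A

/-- `_ω𝒳`: the objects `A` with an infinite `E`-triangle sequence `⋯ → W₂ → W₁ → W₀ → A`, glued
from conflations `Kₙ₊₁ → Wₙ → Kₙ` with `K₀ = A`, all `Wₙ ∈ ω` and all `Kₙ ∈ ω^⊥`. -/
def properRes [ℰ.EnoughProj] (ω : ObjectProperty C) : ObjectProperty C := fun A =>
  ∃ K W : ℕ → C, K 0 = A ∧ ∀ n : ℕ, ω (W n) ∧ ℰ.rightPerp ω (K n) ∧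
    ∃ (g : K (n + 1) ⟶ W n) (f : W n ⟶ K n), ℰ.IsConflation g f

/-- `𝒯` is `𝒞`-tilting, i.e. `(𝒞, 𝒯)` is a tilting pair. -/
structure IsTilting [ℰ.EnoughProj] (𝒞 𝒯 : ObjectProperty C) : Prop where
  selfOrthogonal_left : ℰ.SelfOrthogonal 𝒞
  selfOrthogonal_right : ℰ.SelfOrthogonal 𝒯
  le_hat : 𝒯 ≤ ℰ.hat 𝒞
  le_check : 𝒞 ≤ ℰ.check 𝒯

/-- `ℐ` is a relative injective cogenerator of `𝒴`. -/
structure IsRelInjCogenerator [ℰ.EnoughProj] (ℐ 𝒴 : ObjectProperty C) : Prop where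
  isSubcategory : IsSubcategory ℐ
  le : ℐ ≤ 𝒴
  le_perp : ℐ ≤ ℰ.rightPerp 𝒴
  exists_conflation : ∀ Y : C, 𝒴 Y → ∃ (I Y' : C) (x : Y ⟶ I) (y : I ⟶ Y'),
    ℐ I ∧ 𝒴 Y' ∧ ℰ.IsConflation x y

/-- `M` has a finite `S`-filtration `0 = M₀ → M₁ → ⋯ → Mₙ = M` with conflations
`Mᵢ₋₁ → Mᵢ → Sᵢ`, `Sᵢ ∈ S`. -/
inductive HasFiltration (S : Set C) : C → Prop
  | zero {Z : C} : IsZero Z → HasFiltration S Z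
  | step {M M' s : C} (x : M ⟶ M') (y : M' ⟶ s) :
      HasFiltration S M → s ∈ S → ℰ.IsConflation x y → HasFiltration S M'

/-- There is a finite set of objects of `𝒴` that filters every object of `𝒴`. -/
def FinitelyFiltered (𝒴 : ObjectProperty C) : Prop :=
  ∃ S : Set C, S.Finite ∧ (∀ s ∈ S, 𝒴 s) ∧ ∀ M : C, 𝒴 M → ℰ.HasFiltration S M

/-- `𝒟` is a relative resolving subcategory of `𝒴`. -/
structure IsRelResolving (𝒟 𝒴 : ObjectProperty C) : Prop where
  le : 𝒟 ≤ 𝒴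
  extension : ∀ {A B X : C} (x : A ⟶ B) (y : B ⟶ X), ℰ.IsConflationIn 𝒴 x y → 𝒟 A → 𝒟 X → 𝒟 B
  summand : ∀ {A B : C}, 𝒟 (A ⊞ B) → 𝒟 A
  cocone : ∀ {A B X : C} (x : A ⟶ B) (y : B ⟶ X), ℰ.IsConflationIn 𝒴 x y → 𝒟 B → 𝒟 X → 𝒟 A
  proj_le : ℰ.projIn 𝒴 ≤ 𝒟

/-- `𝒟` is strongly contravariantly finite in `𝒴`. -/
def StronglyContravariantlyFiniteIn (𝒟 𝒴 : ObjectProperty C) : Prop :=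
  ∀ X : C, 𝒴 X → ∃ (K W : C) (k : K ⟶ W) (g : W ⟶ X),
    ℰ.IsConflationIn 𝒴 k g ∧ IsRightApprox 𝒟 g

end ExtriangulatedStructure

end Extri

/-! Inside `𝒴 = properRes 𝒞` the projectives are exactly the objects of `𝒞`, and `hat 𝒞` consists of
the objects of finite relative projective dimension (`relDimLE`). The inverse of the map sends `𝒟`
to its Ext-injectives `𝒟 ∩ 𝒟^⊥` (`extInj`).

From `𝒯` to `𝒟`: self-orthogonality permits horseshoe arguments, so `check 𝒯` is closed under
extensions, cocones and summands. Since `𝒯 = add T`, one `n` bounds the relative dimension of all of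
`𝒯`. Dimension shifting along `n` successive `𝒞`-syzygies then kills all `Eⁱ(𝒯, -)`
(`IsTilting.exists_tri_vanishing`), and a pushout gives approximations with kernel in `𝒯^⊥`. That
`𝒯` can be recovered is `IsTilting.mem_iff`.

From `𝒟` to `𝒯`: Krull–Schmidt and (WIC) provide right minimal approximations, and Wakamatsu's lemma
makes their kernels orthogonal to `𝒟`. With the injective cogenerator, Salce's trick embeds each
object of `𝒟` into an Ext-injective of `𝒟` with cokernel in `𝒟`. These coresolutions terminate once
the relative dimension is bounded on `𝒟`, and the filtration supplies the bound. Each filtering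
object `s` has a conflation `K → Z → s` with `K ∈ 𝒴 ∩ 𝒟^⊥` and `Z ∈ check 𝒟`, and such conflations
glue along filtrations because `E²(Z', K) = 0` (`exists_tri_of_hasFiltration`). Over `X ∈ 𝒟` the
glued conflation splits, so `X` is a summand of an object built from finitely many `Z`. This bounds
dimensions; after embedding each `Z` into an Ext-injective it also gives a single additive
generator. -/

namespace Extri

/-! ### Exact sequences and diagram lemmas for conflations -/

section Functoriality

variable {C : Type u} [Category.{v} C] (E : Cᵒᵖ ⥤ C ⥤ AddCommGrpCat.{w})

theorem push_id {X A : C} (δ : Extn E X A) : push E (𝟙 A) δ = δ := by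
  simp [push]

theorem push_comp {X A A' A'' : C} (a : A ⟶ A') (b : A' ⟶ A'') (δ : Extn E X A) :
    push E (a ≫ b) δ = push E b (push E a δ) := by
  simp [push]

theorem push_add {X A A' : C} (a : A ⟶ A') (δ δ' : Extn E X A) :
    push E a (δ + δ') = push E a δ + push E a δ' :=
  map_add _ _ _

theorem push_zero {X A A' : C} (a : A ⟶ A') : push E a (0 : Extn E X A) = 0 :=
  map_zero _

theorem pull_id {X A : C} (δ : Extn E X A) : pull E (𝟙 X) δ = δ := by
  simp [pull]

theorem pull_comp {X X' X'' A : C} (c : X' ⟶ X) (d : X'' ⟶ X') (δ : Extn E X A) :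
    pull E (d ≫ c) δ = pull E d (pull E c δ) := by
  simp [pull]

theorem pull_add {X X' A : C} (c : X' ⟶ X) (δ δ' : Extn E X A) :
    pull E c (δ + δ') = pull E c δ + pull E c δ' :=
  map_add _ _ _

theorem pull_zero {X X' A : C} (c : X' ⟶ X) : pull E c (0 : Extn E X A) = 0 :=
  map_zero _

theorem push_pull {X X' A A' : C} (a : A ⟶ A') (c : X' ⟶ X) (δ : Extn E X A) :
    push E a (pull E c δ) = pull E c (push E a δ) := by
  have h := congrArg (fun f => f.hom δ) ((E.map c.op).naturality a)
  exact h.symm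

end Functoriality

namespace ExtriangulatedStructure

variable {C : Type u} [Category.{v} C] [Preadditive C] [HasFiniteBiproducts C]
variable (ℰ : ExtriangulatedStructure.{w} C)

theorem push_zero_hom {X A A' : C} (δ : Extn ℰ.E X A) : push ℰ.E (0 : A ⟶ A') δ = 0 := by
  have := ℰ.additive_right (op X)
  simp [push]

theorem pull_zero_hom {X X' A : C} (δ : Extn ℰ.E X A) : pull ℰ.E (0 : X' ⟶ X) δ = 0 := by
  have := ℰ.additive_left
  simp [pull]

variable {ℰ}

theorem realizes_of_iso {A B B' X : C} {x : A ⟶ B} {y : B ⟶ X} {δ : Extn ℰ.E X A}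
    (h : ℰ.Realizes x y δ) (b : B ≅ B') : ℰ.Realizes (x ≫ b.hom) (b.inv ≫ y) δ :=
  (ℰ.realizes_iff _ _ h).2 ⟨b, rfl, by simp⟩

variable (ℰ) in
theorem realizes_id_zero (A : C) {Z : C} (hZ : IsZero Z) :
    ℰ.Realizes (𝟙 A) (0 : A ⟶ Z) (0 : Extn ℰ.E Z A) := by
  refine (ℰ.realizes_iff _ _ (ℰ.realizes_zero A Z)).2 ⟨⟨biprod.fst, biprod.inl, ?_, ?_⟩, ?_, ?_⟩
  · apply biprod.hom_ext'
    · simp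
    · exact hZ.eq_of_src _ _
  · simp
  · simp
  · exact hZ.eq_of_tgt _ _

variable (ℰ) in
theorem realizes_zero_id (X : C) {Z : C} (hZ : IsZero Z) :
    ℰ.Realizes (0 : Z ⟶ X) (𝟙 X) (0 : Extn ℰ.E X Z) := by
  refine (ℰ.realizes_iff _ _ (ℰ.realizes_zero Z X)).2 ⟨⟨biprod.snd, biprod.inr, ?_, ?_⟩, ?_, ?_⟩
  · apply biprod.hom_ext'
    · exact hZ.eq_of_src _ _
    · simp
  · simp
  · exact hZ.eq_of_src _ _
  · simp

variable (ℰ) in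
theorem realizes_zero' (A X : C) :
    ℰ.Realizes (biprod.inr : X ⟶ A ⊞ X) (biprod.fst : A ⊞ X ⟶ A) (0 : Extn ℰ.E A X) := by
  have h := realizes_of_iso (ℰ.realizes_zero X A) (biprod.braiding X A)
  have h1 : biprod.inl ≫ (biprod.braiding X A).hom = biprod.inr := by ext <;> simp
  have h2 : (biprod.braiding X A).inv ≫ biprod.snd = biprod.fst := by simp
  rwa [h1, h2] at h

section Exactness

variable {A B X : C} {x : A ⟶ B} {y : B ⟶ X} {δ : Extn ℰ.E X A}

/-- Exactness here and below comes from comparison, by (ET3) or its dual, with the trivial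
conflations `A = A → 0` and `0 → A = A`. -/
theorem Realizes.comp_eq_zero (h : ℰ.Realizes x y δ) : x ≫ y = 0 := by
  obtain ⟨c, hc, -⟩ := ℰ.et3 (ℰ.realizes_id_zero A (isZero_zero C)) h (𝟙 A) x (by simp)
  simpa using hc.symm

theorem Realizes.push_eq_zero (h : ℰ.Realizes x y δ) : push ℰ.E x δ = 0 := by
  obtain ⟨c, -, hc⟩ := ℰ.et3 h (ℰ.realizes_id_zero B (isZero_zero C)) x (𝟙 B) (by simp)
  rw [hc, pull_zero]

theorem Realizes.pull_eq_zero (h : ℰ.Realizes x y δ) : pull ℰ.E y δ = 0 := by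
  obtain ⟨c, -, hc⟩ := ℰ.et3_op (ℰ.realizes_zero_id B (isZero_zero C)) h (𝟙 B) y (by simp)
  rw [← hc, push_zero]

theorem Realizes.exists_lift_kernel (h : ℰ.Realizes x y δ) {Z : C} (f : Z ⟶ B) (hf : f ≫ y = 0) :
    ∃ a : Z ⟶ A, a ≫ x = f := by
  obtain ⟨a, ha, -⟩ := ℰ.et3_op (ℰ.realizes_id_zero Z (isZero_zero C)) h f 0 (by simp [hf])
  exact ⟨a, by simpa using ha.symm⟩

theorem Realizes.exists_desc_cokernel (h : ℰ.Realizes x y δ) {Z : C} (f : B ⟶ Z)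
    (hf : x ≫ f = 0) : ∃ c : X ⟶ Z, y ≫ c = f := by
  obtain ⟨c, hc, -⟩ := ℰ.et3 h (ℰ.realizes_zero_id Z (isZero_zero C)) 0 f (by simp [hf])
  exact ⟨c, by simpa using hc⟩

theorem Realizes.exists_lift (h : ℰ.Realizes x y δ) {Z : C} (c : Z ⟶ X)
    (hc : pull ℰ.E c δ = 0) : ∃ b : Z ⟶ B, b ≫ y = c := by
  obtain ⟨b, -, hb⟩ := ℰ.exists_realizes_morphism (ℰ.realizes_zero A Z) h (𝟙 A) c
    (by rw [hc, push_zero])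
  exact ⟨biprod.inr ≫ b, by rw [Category.assoc, ← hb]; simp⟩

theorem Realizes.exists_extend (h : ℰ.Realizes x y δ) {Z : C} (a : A ⟶ Z)
    (ha : push ℰ.E a δ = 0) : ∃ b : B ⟶ Z, x ≫ b = a := by
  obtain ⟨b, hb, -⟩ := ℰ.exists_realizes_morphism h (ℰ.realizes_zero Z X) a (𝟙 X)
    (by rw [ha, pull_zero])
  exact ⟨b ≫ biprod.fst, by rw [← Category.assoc, hb]; simp⟩

theorem Realizes.pull_eq_zero_of_lift (h : ℰ.Realizes x y δ) {Z : C} (b : Z ⟶ B) :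
    pull ℰ.E (b ≫ y) δ = 0 := by
  rw [pull_comp, h.pull_eq_zero, pull_zero]

theorem Realizes.push_eq_zero_of_extend (h : ℰ.Realizes x y δ) {Z : C} (b : B ⟶ Z) :
    push ℰ.E (x ≫ b) δ = 0 := by
  rw [push_comp, h.push_eq_zero, push_zero]

theorem Realizes.exists_pull_eq (h : ℰ.Realizes x y δ) {Z : C} (ε : Extn ℰ.E Z A)
    (hε : push ℰ.E x ε = 0) : ∃ c : Z ⟶ X, pull ℰ.E c δ = ε := by
  obtain ⟨N, i, p, hN⟩ := ℰ.exists_realizes ε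
  obtain ⟨b, hb⟩ := hN.exists_extend x hε
  obtain ⟨c, -, hc⟩ := ℰ.et3 hN h (𝟙 A) b (by simp [hb])
  exact ⟨c, by rw [← hc, push_id]⟩

theorem Realizes.exists_push_eq (h : ℰ.Realizes x y δ) {Z : C} (ε : Extn ℰ.E X Z)
    (hε : pull ℰ.E y ε = 0) : ∃ a : A ⟶ Z, push ℰ.E a δ = ε := by
  obtain ⟨N, i, p, hN⟩ := ℰ.exists_realizes ε
  obtain ⟨b, hb⟩ := hN.exists_lift y hε
  obtain ⟨a, -, ha⟩ := ℰ.et3_op h hN b (𝟙 X) (by simp [hb])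
  exact ⟨a, by rw [ha, pull_id]⟩

/-- Apply (ET4) to `x` followed by the inflation of `ε`: the induced conflation realizes `y_* ε =
0`, and pulling back along a section of its deflation gives the preimage. -/
theorem Realizes.exists_push_inflation (h : ℰ.Realizes x y δ) {Z : C} (ε : Extn ℰ.E Z B)
    (hε : push ℰ.E y ε = 0) : ∃ ε' : Extn ℰ.E Z A, push ℰ.E x ε' = ε := by
  obtain ⟨N, i, p, hN⟩ := ℰ.exists_realizes ε
  obtain ⟨W, h', d, e, δ'', -, -, -, hW, -, hδ⟩ := ℰ.et4 h hN
  obtain ⟨s, hs⟩ := hW.exists_lift (𝟙 Z) (by rw [hε, pull_zero])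
  exact ⟨pull ℰ.E s δ'', by rw [push_pull, hδ, ← pull_comp, hs, pull_id]⟩

theorem Realizes.exists_pull_deflation (h : ℰ.Realizes x y δ) {Z : C} (ε : Extn ℰ.E B Z)
    (hε : pull ℰ.E x ε = 0) : ∃ ε' : Extn ℰ.E X Z, pull ℰ.E y ε' = ε := by
  obtain ⟨N, i, p, hN⟩ := ℰ.exists_realizes ε
  obtain ⟨W, h', d, e, δ'', -, -, -, hW, -, hδ⟩ := ℰ.et4_op hN h
  obtain ⟨s, hs⟩ := hW.exists_extend (𝟙 Z) (by rw [hε, push_zero])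
  exact ⟨push ℰ.E s δ'', by rw [← push_pull, hδ, ← push_comp, hs, push_id]⟩

/-- A morphism of realized extensions with invertible outer components is invertible. -/
theorem Realizes.isIso_middle (h : ℰ.Realizes x y δ) {A' B' X' : C} {x' : A' ⟶ B'} {y' : B' ⟶ X'}
    {δ' : Extn ℰ.E X' A'} (h' : ℰ.Realizes x' y' δ') (a : A ≅ A') (c : X ≅ X') (b : B ⟶ B')
    (hδ : push ℰ.E a.hom δ = pull ℰ.E c.hom δ') (hx : x ≫ b = a.hom ≫ x')
    (hy : y ≫ c.hom = b ≫ y') : IsIso b := by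
  have hδ' : push ℰ.E a.inv δ' = pull ℰ.E c.inv δ := by
    have h1 := congrArg (fun e => push ℰ.E a.inv (pull ℰ.E c.inv e)) hδ
    simp only [← pull_comp, Iso.inv_hom_id, pull_id] at h1
    rw [push_pull, ← push_comp, Iso.hom_inv_id, push_id] at h1
    exact h1.symm
  have hsec : ∃ s : B' ⟶ B, s ≫ b = 𝟙 B' := by
    obtain ⟨s, hs⟩ := h.exists_lift (y' ≫ c.inv) (by
      rw [pull_comp, ← hδ', ← push_pull, h'.pull_eq_zero, push_zero])
    -- The error of `s` as a section vanishes in `X'`, so it comes from `A'` and can be corrected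
    -- through `x`.
    obtain ⟨t, ht⟩ := h'.exists_lift_kernel (𝟙 B' - s ≫ b) (by
      rw [Preadditive.sub_comp, Category.assoc, ← hy, reassoc_of% hs]; simp)
    refine ⟨s + t ≫ a.inv ≫ x, ?_⟩
    rw [Preadditive.add_comp, Category.assoc, Category.assoc, hx, Iso.inv_hom_id_assoc, ht]
    abel
  have hret : ∃ s : B' ⟶ B, b ≫ s = 𝟙 B := by
    obtain ⟨s, hs⟩ := h'.exists_extend (a.inv ≫ x) (by
      rw [push_comp, hδ', push_pull, h.push_eq_zero, pull_zero])
    obtain ⟨t, ht⟩ := h.exists_desc_cokernel (𝟙 B - b ≫ s) (by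
      rw [Preadditive.comp_sub, reassoc_of% hx, hs]; simp)
    refine ⟨s + y' ≫ c.inv ≫ t, ?_⟩
    rw [Preadditive.comp_add, ← reassoc_of% hy, Iso.hom_inv_id_assoc, ht]
    abel
  obtain ⟨s, hs⟩ := hsec
  obtain ⟨r, hr⟩ := hret
  have : r = s := by rw [← Category.comp_id s, ← hr, reassoc_of% hs]
  exact ⟨s, by rw [← this, hr], hs⟩

theorem Realizes.exists_iso_middle (h : ℰ.Realizes x y δ) {A' B' X' : C} {x' : A' ⟶ B'}
    {y' : B' ⟶ X'} {δ' : Extn ℰ.E X' A'} (h' : ℰ.Realizes x' y' δ') (a : A ≅ A') (c : X ≅ X')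
    (hδ : push ℰ.E a.hom δ = pull ℰ.E c.hom δ') :
    ∃ b : B ≅ B', x ≫ b.hom = a.hom ≫ x' ∧ y ≫ c.hom = b.hom ≫ y' := by
  obtain ⟨b, hx, hy⟩ := ℰ.exists_realizes_morphism h h' a.hom c.hom hδ
  have := h.isIso_middle h' a c b hδ hx hy
  exact ⟨asIso b, hx, hy⟩

theorem Realizes.of_iso (h : ℰ.Realizes x y δ) {A' X' : C} (a : A ≅ A') (c : X ≅ X') :
    ℰ.Realizes (a.inv ≫ x) (y ≫ c.hom) (push ℰ.E a.hom (pull ℰ.E c.inv δ)) := by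
  obtain ⟨B', x', y', h'⟩ := ℰ.exists_realizes (push ℰ.E a.hom (pull ℰ.E c.inv δ))
  obtain ⟨b, hx, hy⟩ := h.exists_iso_middle h' a c (by
    rw [← push_pull, ← pull_comp, Iso.hom_inv_id, pull_id])
  refine (ℰ.realizes_iff _ _ h').2 ⟨b.symm, ?_, ?_⟩
  · rw [Iso.eq_inv_comp, ← reassoc_of% hx]; simp
  · rw [hy]; simp

end Exactness

theorem IsConflation.of_iso {A B X A' B' X' : C} {x : A ⟶ B} {y : B ⟶ X}
    (h : ℰ.IsConflation x y) (a : A ≅ A') (b : B ≅ B') (c : X ≅ X') :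
    ℰ.IsConflation (a.inv ≫ x ≫ b.hom) (b.inv ≫ y ≫ c.hom) := by
  obtain ⟨δ, hδ⟩ := h
  have := realizes_of_iso (hδ.of_iso a c) b
  rw [Category.assoc] at this
  exact ⟨_, this⟩

variable (ℰ) in
/-- There is a conflation `A ⟶ B ⟶ X`. -/
def Tri (A B X : C) : Prop := ∃ (x : A ⟶ B) (y : B ⟶ X), ℰ.IsConflation x y

section Tri

variable {A B X A' B' X' : C}

theorem IsConflation.tri {x : A ⟶ B} {y : B ⟶ X} (h : ℰ.IsConflation x y) : ℰ.Tri A B X :=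
  ⟨x, y, h⟩

theorem Realizes.tri {x : A ⟶ B} {y : B ⟶ X} {δ : Extn ℰ.E X A} (h : ℰ.Realizes x y δ) :
    ℰ.Tri A B X :=
  ⟨x, y, δ, h⟩

theorem Tri.of_iso (h : ℰ.Tri A B X) (a : A ≅ A') (b : B ≅ B') (c : X ≅ X') : ℰ.Tri A' B' X' := by
  obtain ⟨x, y, h⟩ := h
  exact (h.of_iso a b c).tri

variable (ℰ) in
theorem tri_split (A X : C) : ℰ.Tri A (A ⊞ X) X := (ℰ.realizes_zero A X).tri

variable (ℰ) in
theorem tri_id_zero (A : C) {Z : C} (hZ : IsZero Z) : ℰ.Tri A A Z :=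
  (ℰ.realizes_id_zero A hZ).tri

variable (ℰ) in
theorem tri_zero_id (A : C) {Z : C} (hZ : IsZero Z) : ℰ.Tri Z A A :=
  (ℰ.realizes_zero_id A hZ).tri

theorem Tri.sum (h : ℰ.Tri A B X) (h' : ℰ.Tri A' B' X') : ℰ.Tri (A ⊞ A') (B ⊞ B') (X ⊞ X') := by
  obtain ⟨x, y, δ, h⟩ := h
  obtain ⟨x', y', δ', h'⟩ := h'
  exact (ℰ.realizes_sum h h').tri

theorem Tri.comp_inflation {G F : C} (h : ℰ.Tri A B X) (h' : ℰ.Tri B G F) :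
    ∃ Z, ℰ.Tri A G Z ∧ ℰ.Tri X Z F := by
  obtain ⟨x, y, δ, h⟩ := h
  obtain ⟨x', y', δ', h'⟩ := h'
  obtain ⟨Z, _, _, _, _, -, -, h1, h2, -, -⟩ := ℰ.et4 h h'
  exact ⟨Z, h1.tri, h2.tri⟩

theorem Tri.comp_deflation {D F G : C} (h : ℰ.Tri D A B) (h' : ℰ.Tri F B G) :
    ∃ Z, ℰ.Tri Z A G ∧ ℰ.Tri D Z F := by
  obtain ⟨x, y, δ, h⟩ := h
  obtain ⟨x', y', δ', h'⟩ := h'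
  obtain ⟨Z, _, _, _, _, -, -, h1, h2, -, -⟩ := ℰ.et4_op h h'
  exact ⟨Z, h1.tri, h2.tri⟩

theorem Realizes.iso_of_eq {x : A ⟶ B} {y : B ⟶ X} {x' : A ⟶ B'} {y' : B' ⟶ X}
    {δ : Extn ℰ.E X A} (h : ℰ.Realizes x y δ) (h' : ℰ.Realizes x' y' δ) : Nonempty (B ≅ B') := by
  obtain ⟨b, -⟩ := (ℰ.realizes_iff x' y' h).1 h'
  exact ⟨b⟩

/-- Two deflations with the same target have a pullback. -/
theorem Tri.pullback {A₁ B₁ A₂ B₂ : C} (h₁ : ℰ.Tri A₁ B₁ X) (h₂ : ℰ.Tri A₂ B₂ X) :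
    ∃ M, ℰ.Tri A₂ M B₁ ∧ ℰ.Tri A₁ M B₂ := by
  obtain ⟨x₁, y₁, δ₁, h₁⟩ := h₁
  obtain ⟨x₂, y₂, δ₂, h₂⟩ := h₂
  -- `M` is the middle term of the extension of `X` by `A₁ ⊞ A₂` with components `δ₁`, `δ₂`;
  -- dividing out one summand by (ET4) leaves the other given conflation.
  obtain ⟨M, x, y, h⟩ := ℰ.exists_realizes
    (push ℰ.E (biprod.inl : A₁ ⟶ A₁ ⊞ A₂) δ₁ + push ℰ.E biprod.inr δ₂)
  obtain ⟨Z, _, _, _, _, -, -, h3, h4, -, -⟩ := ℰ.et4 (ℰ.realizes_zero A₁ A₂) h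
  obtain ⟨Z', _, _, _, _, -, -, h5, h6, -, -⟩ := ℰ.et4 (ℰ.realizes_zero' A₁ A₂) h
  rw [push_add, ← push_comp, ← push_comp] at h4 h6
  simp only [biprod.inl_snd, biprod.inr_snd, biprod.inl_fst, biprod.inr_fst, push_id,
    push_zero_hom, zero_add, add_zero] at h4 h6
  obtain ⟨e⟩ := h4.iso_of_eq h₂
  obtain ⟨e'⟩ := h6.iso_of_eq h₁
  exact ⟨M, h5.tri.of_iso (Iso.refl _) (Iso.refl _) e', h3.tri.of_iso (Iso.refl _) (Iso.refl _) e⟩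

/-- Two inflations with the same source have a pushout. -/
theorem Tri.pushout {B₁ X₁ B₂ X₂ : C} (h₁ : ℰ.Tri A B₁ X₁) (h₂ : ℰ.Tri A B₂ X₂) :
    ∃ M, ℰ.Tri B₁ M X₂ ∧ ℰ.Tri B₂ M X₁ := by
  obtain ⟨x₁, y₁, δ₁, h₁⟩ := h₁
  obtain ⟨x₂, y₂, δ₂, h₂⟩ := h₂
  obtain ⟨M, x, y, h⟩ := ℰ.exists_realizes
    (pull ℰ.E (biprod.fst : X₁ ⊞ X₂ ⟶ X₁) δ₁ + pull ℰ.E biprod.snd δ₂)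
  obtain ⟨Z, _, _, _, _, -, -, h3, h4, -, -⟩ := ℰ.et4_op h (ℰ.realizes_zero X₁ X₂)
  obtain ⟨Z', _, _, _, _, -, -, h5, h6, -, -⟩ := ℰ.et4_op h (ℰ.realizes_zero' X₁ X₂)
  rw [pull_add, ← pull_comp, ← pull_comp] at h4 h6
  simp only [biprod.inl_snd, biprod.inr_snd, biprod.inl_fst, biprod.inr_fst, pull_id,
    pull_zero_hom, zero_add, add_zero] at h4 h6
  obtain ⟨e⟩ := h4.iso_of_eq h₁
  obtain ⟨e'⟩ := h6.iso_of_eq h₂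
  exact ⟨M, h3.tri.of_iso e (Iso.refl _) (Iso.refl _), h5.tri.of_iso e' (Iso.refl _) (Iso.refl _)⟩

theorem Tri.iso_biprod (h : ℰ.Tri A B X) (h0 : ∀ e : Extn ℰ.E X A, e = 0) :
    Nonempty (B ≅ A ⊞ X) := by
  obtain ⟨x, y, δ, h⟩ := h
  rw [h0 δ] at h
  exact h.iso_of_eq (ℰ.realizes_zero A X)

end Tri

end ExtriangulatedStructure

end Extri

/-! ### Vanishing of higher extensions and dimension shifting -/

namespace Extri

namespace ExtriangulatedStructure

variable {C : Type u} [Category.{v} C] [Preadditive C] [HasFiniteBiproducts C]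
variable {ℰ : ExtriangulatedStructure.{w} C}

section ExtVanish

variable {A B X Y Z : C}

variable (ℰ) in
/-- `E(X, Y) = 0` -/
def ExtVanish (X Y : C) : Prop := ∀ e : Extn ℰ.E X Y, e = 0

theorem ExtVanish.of_retract_left (h : ℰ.ExtVanish B Y) (i : A ⟶ B) (p : B ⟶ A)
    (hip : i ≫ p = 𝟙 A) : ℰ.ExtVanish A Y := fun e => by
  rw [← pull_id ℰ.E e, ← hip, pull_comp, h (pull ℰ.E p e), pull_zero]

theorem ExtVanish.of_retract_right (h : ℰ.ExtVanish Y B) (i : A ⟶ B) (p : B ⟶ A)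
    (hip : i ≫ p = 𝟙 A) : ℰ.ExtVanish Y A := fun e => by
  rw [← push_id ℰ.E e, ← hip, push_comp, h (push ℰ.E i e), push_zero]

theorem Tri.extVanish_left (h : ℰ.Tri A B X) (hA : ℰ.ExtVanish A Y) (hX : ℰ.ExtVanish X Y) :
    ℰ.ExtVanish B Y := fun e => by
  obtain ⟨x, y, δ, h⟩ := h
  obtain ⟨e', rfl⟩ := h.exists_pull_deflation e (hA _)
  rw [hX e', pull_zero]

theorem Tri.extVanish_right (h : ℰ.Tri A B X) (hA : ℰ.ExtVanish Z A) (hX : ℰ.ExtVanish Z X) :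
    ℰ.ExtVanish Z B := fun e => by
  obtain ⟨x, y, δ, h⟩ := h
  obtain ⟨e', rfl⟩ := h.exists_push_inflation e (hX _)
  rw [hA e', push_zero]

theorem ExtVanish.of_proj {P : C} (hP : ℰ.proj P) (Y : C) : ℰ.ExtVanish P Y := fun e => by
  obtain ⟨B, x, y, h⟩ := ℰ.exists_realizes e
  obtain ⟨b, hb⟩ := hP.2 x y ⟨trivial, trivial, trivial, _, h⟩ (𝟙 P)
  rw [← pull_id ℰ.E e, ← hb, h.pull_eq_zero_of_lift]

theorem ExtVanish.of_inj {I : C} (hI : ℰ.inj I) (X : C) : ℰ.ExtVanish X I := fun e => by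
  obtain ⟨B, x, y, h⟩ := ℰ.exists_realizes e
  obtain ⟨b, hb⟩ := hI x y ⟨_, h⟩ (𝟙 I)
  rw [← push_id ℰ.E e, ← hb, h.push_eq_zero_of_extend]

/-- Balance of Ext: both kinds of extension come from maps `K ⟶ L`, and such a map lifts to `I`
exactly when it extends to `P`, either being equivalent to factoring through some `P ⟶ I`. -/
theorem Tri.extVanish_kernel_iff {K P I L : C} (h : ℰ.Tri K P X) (hP : ℰ.proj P)
    (h' : ℰ.Tri Y I L) (hI : ℰ.inj I) : ℰ.ExtVanish K Y ↔ ℰ.ExtVanish X L := by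
  obtain ⟨k, p, δ, h⟩ := h
  obtain ⟨i, l, ε, h'⟩ := h'
  constructor
  · intro hK e
    obtain ⟨f, rfl⟩ := h.exists_push_eq e (ExtVanish.of_proj hP _ _)
    obtain ⟨g, rfl⟩ := h'.exists_lift f (hK _)
    obtain ⟨b, rfl⟩ := hI k p ⟨_, h⟩ g
    rw [Category.assoc, h.push_eq_zero_of_extend]
  · intro hX e
    obtain ⟨f, rfl⟩ := h'.exists_pull_eq e (ExtVanish.of_inj hI _ _)
    obtain ⟨g, rfl⟩ := h.exists_extend f (hX _)
    obtain ⟨b, rfl⟩ := hP.2 i l ⟨trivial, trivial, trivial, _, h'⟩ g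
    rw [← Category.assoc, h'.pull_eq_zero_of_lift]

/-- Replaces rotation of a triangle, with `L` in the role of the shift of `A`: the pushout along `A
→ I` splits. -/
theorem Tri.rotate_inj {I L : C} (h : ℰ.Tri A B X) (hL : ℰ.Tri A I L) (hI : ℰ.inj I) :
    ℰ.Tri B (I ⊞ X) L := by
  obtain ⟨M, h1, h2⟩ := h.pushout hL
  obtain ⟨e⟩ := h2.iso_biprod (ExtVanish.of_inj hI _)
  exact h1.of_iso (Iso.refl _) e (Iso.refl _)

theorem Tri.rotate_proj {K P : C} (h : ℰ.Tri A B X) (hK : ℰ.Tri K P X) (hP : ℰ.proj P) :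
    ℰ.Tri K (A ⊞ P) B := by
  obtain ⟨M, h1, h2⟩ := h.pullback hK
  obtain ⟨e⟩ := h2.iso_biprod (ExtVanish.of_proj hP _)
  exact h1.of_iso (Iso.refl _) e (Iso.refl _)

end ExtVanish

section HigherVanish

variable [ℰ.EnoughProj] {A B X Y Z : C} {i : ℕ}

variable (ℰ) in
/-- `Eⁱ⁺¹(X, Y) = 0` -/
def HigherVanish (i : ℕ) (X Y : C) : Prop := ∀ e : ℰ.HigherExtSucc i X Y, e = 0

variable (ℰ) in
/-- `Eⁱ(X, Y) = 0` for all `i ≥ 1` -/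
def Orth (X Y : C) : Prop := ∀ i, ℰ.HigherVanish i X Y

theorem Orth.extVanish (h : ℰ.Orth X Y) : ℰ.ExtVanish X Y := h 0

theorem HigherVanish.of_retract_right (h : ℰ.HigherVanish i Y B) (s : A ⟶ B) (p : B ⟶ A)
    (hsp : s ≫ p = 𝟙 A) : ℰ.HigherVanish i Y A :=
  ExtVanish.of_retract_right h s p hsp

theorem HigherVanish.of_inj {I : C} (hI : ℰ.inj I) (X : C) : ℰ.HigherVanish i X I :=
  ExtVanish.of_inj hI _

theorem Tri.higherVanish_right (h : ℰ.Tri A B X) (hA : ℰ.HigherVanish i Z A)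
    (hX : ℰ.HigherVanish i Z X) : ℰ.HigherVanish i Z B :=
  h.extVanish_right hA hX

theorem exists_tri_syzygy (ℰ : ExtriangulatedStructure.{w} C) [ℰ.EnoughProj] (X : C) :
    ∃ P, ℰ.proj P ∧ ℰ.Tri (ℰ.syzygy X) P X := by
  obtain ⟨P, x, y, hP, h⟩ := (EnoughProj.exists_conflation (ℰ := ℰ) X).choose_spec
  exact ⟨P, hP, h.tri⟩

theorem exists_tri_inj (ℰ : ExtriangulatedStructure.{w} C) [ℰ.EnoughInj] (Y : C) :
    ∃ I L, ℰ.inj I ∧ ℰ.Tri Y I L := by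
  obtain ⟨I, L, x, y, hI, h⟩ := EnoughInj.exists_conflation (ℰ := ℰ) Y
  exact ⟨I, L, hI, h.tri⟩

theorem Tri.higherVanish_succ_iff_inj {I L : C} (h : ℰ.Tri Y I L) (hI : ℰ.inj I) :
    ℰ.HigherVanish (i + 1) X Y ↔ ℰ.HigherVanish i X L := by
  obtain ⟨P, hP, hP'⟩ := exists_tri_syzygy ℰ (ℰ.iterSyzygy i X)
  exact hP'.extVanish_kernel_iff hP h hI

theorem Tri.orth_right (h : ℰ.Tri A B X) (hA : ℰ.Orth Z A) (hX : ℰ.Orth Z X) : ℰ.Orth Z B :=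
  fun i => h.higherVanish_right (hA i) (hX i)

theorem Orth.biprod_right (hA : ℰ.Orth Z A) (hB : ℰ.Orth Z B) : ℰ.Orth Z (A ⊞ B) :=
  (ℰ.tri_split A B).orth_right hA hB

theorem Orth.of_isZero_right (hZ : IsZero Z) (X : C) : ℰ.Orth X Z := fun _ =>
  HigherVanish.of_inj (fun _ _ _ _ => ⟨0, hZ.eq_of_tgt _ _⟩) X

variable [ℰ.EnoughInj]

/-- Shows independence of the chosen syzygy. Higher degrees are moved to cosyzygies of `Y`, where
balance settles the base case. -/
theorem Tri.higherVanish_succ_iff_proj {K P : C} (h : ℰ.Tri K P X) (hP : ℰ.proj P) :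
    ℰ.HigherVanish (i + 1) X Y ↔ ℰ.HigherVanish i K Y := by
  obtain ⟨I, L, hI, hL⟩ := exists_tri_inj ℰ Y
  induction i generalizing Y I L with
  | zero => exact (hL.higherVanish_succ_iff_inj hI).trans (h.extVanish_kernel_iff hP hL hI).symm
  | succ i ih =>
    obtain ⟨I', L', hI', hL'⟩ := exists_tri_inj ℰ L
    rw [hL.higherVanish_succ_iff_inj hI, hL.higherVanish_succ_iff_inj hI, ih I' L' hI' hL']

theorem HigherVanish.of_retract_left (h : ℰ.HigherVanish i B Y) (s : A ⟶ B) (p : B ⟶ A)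
    (hsp : s ≫ p = 𝟙 A) : ℰ.HigherVanish i A Y := by
  induction i generalizing Y with
  | zero => exact ExtVanish.of_retract_left h s p hsp
  | succ i ih =>
    obtain ⟨I, L, hI, hL⟩ := exists_tri_inj ℰ Y
    rw [hL.higherVanish_succ_iff_inj hI] at h ⊢
    exact ih h

theorem HigherVanish.of_proj {P : C} (hP : ℰ.proj P) (Y : C) : ℰ.HigherVanish i P Y := by
  induction i generalizing Y with
  | zero => exact ExtVanish.of_proj hP _
  | succ i ih =>
    obtain ⟨I, L, hI, hL⟩ := exists_tri_inj ℰ Y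
    rw [hL.higherVanish_succ_iff_inj hI]
    exact ih L

theorem Tri.higherVanish_left (h : ℰ.Tri A B X) (hA : ℰ.HigherVanish i A Y)
    (hX : ℰ.HigherVanish i X Y) : ℰ.HigherVanish i B Y := by
  induction i generalizing Y with
  | zero => exact h.extVanish_left hA hX
  | succ i ih =>
    obtain ⟨I, L, hI, hL⟩ := exists_tri_inj ℰ Y
    rw [hL.higherVanish_succ_iff_inj hI] at hA hX ⊢
    exact ih hA hX

/-- A piece of the long exact sequence, read off from the rotated conflation, whose middle term has
`X` as a summand. -/
theorem Tri.higherVanish_cone_right (h : ℰ.Tri A B X) (hB : ℰ.HigherVanish i Z B)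
    (hA : ℰ.HigherVanish (i + 1) Z A) : ℰ.HigherVanish i Z X := by
  obtain ⟨I, L, hI, hL⟩ := exists_tri_inj ℰ A
  rw [hL.higherVanish_succ_iff_inj hI] at hA
  exact ((h.rotate_inj hL hI).higherVanish_right hB hA).of_retract_right
    biprod.inr biprod.snd (by simp)

theorem Tri.higherVanish_cocone_left (h : ℰ.Tri A B X) (hB : ℰ.HigherVanish i B Y)
    (hX : ℰ.HigherVanish (i + 1) X Y) : ℰ.HigherVanish i A Y := by
  obtain ⟨P, hP, hK⟩ := exists_tri_syzygy ℰ X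
  rw [hK.higherVanish_succ_iff_proj hP] at hX
  exact ((h.rotate_proj hK hP).higherVanish_left hX hB).of_retract_left
    biprod.inl biprod.fst (by simp)

theorem Tri.higherVanish_cone_left (h : ℰ.Tri A B X) (hA : ℰ.HigherVanish i A Y)
    (hB : ℰ.HigherVanish (i + 1) B Y) : ℰ.HigherVanish (i + 1) X Y := by
  obtain ⟨P, hP, hK⟩ := exists_tri_syzygy ℰ X
  rw [hK.higherVanish_succ_iff_proj hP]
  exact (h.rotate_proj hK hP).higherVanish_cocone_left
    ((ℰ.tri_split A P).higherVanish_left hA (HigherVanish.of_proj hP _)) hB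

theorem Tri.orth_left (h : ℰ.Tri A B X) (hA : ℰ.Orth A Y) (hX : ℰ.Orth X Y) : ℰ.Orth B Y :=
  fun i => h.higherVanish_left (hA i) (hX i)

theorem Tri.orth_cone_right (h : ℰ.Tri A B X) (hA : ℰ.Orth Z A) (hB : ℰ.Orth Z B) : ℰ.Orth Z X :=
  fun i => h.higherVanish_cone_right (hB i) (hA (i + 1))

theorem Tri.orth_cocone_left (h : ℰ.Tri A B X) (hB : ℰ.Orth B Y) (hX : ℰ.Orth X Y) :
    ℰ.Orth A Y :=
  fun i => h.higherVanish_cocone_left (hB i) (hX (i + 1))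

theorem Orth.of_biprod_left (h : ℰ.Orth (A ⊞ B) Z) : ℰ.Orth A Z :=
  fun i => (h i).of_retract_left biprod.inl biprod.fst (by simp)

theorem Orth.of_iso_left (h : ℰ.Orth A Z) (e : A ≅ B) : ℰ.Orth B Z :=
  fun i => (h i).of_retract_left e.inv e.hom (by simp)

theorem Orth.biprod_left (hA : ℰ.Orth A Z) (hB : ℰ.Orth B Z) : ℰ.Orth (A ⊞ B) Z :=
  (ℰ.tri_split A B).orth_left hA hB

theorem Orth.of_isZero_left (hZ : IsZero Z) (Y : C) : ℰ.Orth Z Y := fun _ =>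
  HigherVanish.of_proj ⟨trivial, fun _ _ _ _ => ⟨0, hZ.eq_of_src _ _⟩⟩ Y

/-- Extensions lift along a deflation whose kernel has no second extensions. -/
theorem Tri.exists_lift_extension {K W M N Q : C} (h : ℰ.Tri K W M) (h' : ℰ.Tri M N Q)
    (hQ : ℰ.HigherVanish 1 Q K) : ∃ N', ℰ.Tri W N' Q ∧ ℰ.Tri K N' N := by
  obtain ⟨I, L, hI, hL⟩ := exists_tri_inj ℰ K
  rw [hL.higherVanish_succ_iff_inj hI] at hQ
  obtain ⟨k, g, κ, h⟩ := h
  obtain ⟨m, n, ε, h'⟩ := h'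
  obtain ⟨i, l, lam, hL⟩ := hL
  -- `κ` is classified by a map `c : M ⟶ L`. The obstruction to extending `c` over `N` lies in `E(Q,
  -- L)`, which vanishes with `E²(Q, K)`.
  obtain ⟨c, hc⟩ := hL.exists_pull_eq κ (ExtVanish.of_inj hI _ _)
  obtain ⟨c', rfl⟩ := h'.exists_extend c (hQ _)
  obtain ⟨N', k', g', hN'⟩ := ℰ.exists_realizes (Extri.pull ℰ.E c' lam)
  obtain ⟨W', _, _, _, _, -, -, h1, h2, -, -⟩ := ℰ.et4_op hN' h'
  rw [← pull_comp, hc] at h2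
  obtain ⟨e⟩ := h2.iso_of_eq h
  exact ⟨N', h1.tri.of_iso e (Iso.refl _) (Iso.refl _), hN'.tri⟩

end HigherVanish

end ExtriangulatedStructure

end Extri

/-! ### Horseshoes, proper resolutions, relative dimension and coresolutions -/

namespace Extri

namespace ExtriangulatedStructure

variable {C : Type u} [Category.{v} C] [Preadditive C] [HasFiniteBiproducts C]
variable {ℰ : ExtriangulatedStructure.{w} C}

section Horseshoe

variable {A B X : C}

/-- The isomorphism `A ⊞ Z ≅ A` for a zero object `Z`. -/
noncomputable def biprodIsZeroIso (A : C) {Z : C} (hZ : IsZero Z) : A ⊞ Z ≅ A where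
  hom := biprod.fst
  inv := biprod.inl
  hom_inv_id := by
    apply biprod.hom_ext'
    · simp
    · exact hZ.eq_of_src _ _

theorem Tri.biprod_right (h : ℰ.Tri A B X) (V : C) : ℰ.Tri A (B ⊞ V) (X ⊞ V) :=
  (h.sum (ℰ.tri_zero_id V (isZero_zero C))).of_iso (biprodIsZeroIso A (isZero_zero C))
    (Iso.refl _) (Iso.refl _)

theorem Tri.biprod_left (h : ℰ.Tri A B X) (V : C) : ℰ.Tri (A ⊞ V) (B ⊞ V) X :=
  (h.sum (ℰ.tri_id_zero V (isZero_zero C))).of_iso (Iso.refl _) (Iso.refl _)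
    (biprodIsZeroIso X (isZero_zero C))

/-- The pullback of `B` along `V → X` splits as `A ⊞ V`; compose its deflation onto `B` with `W ⊞ V
→ A ⊞ V`. -/
theorem Tri.horseshoe_left {K W L V : C} (h : ℰ.Tri A B X) (hA : ℰ.Tri K W A)
    (hX : ℰ.Tri L V X) (h0 : ℰ.ExtVanish V A) :
    ∃ Z, ℰ.Tri K Z L ∧ ℰ.Tri Z (W ⊞ V) B := by
  obtain ⟨M, h1, h2⟩ := h.pullback hX
  obtain ⟨e⟩ := h2.iso_biprod h0
  obtain ⟨Z, h3, h4⟩ := (hA.biprod_right V).comp_deflation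
    (h1.of_iso (Iso.refl _) e (Iso.refl _))
  exact ⟨Z, h4, h3⟩

theorem Tri.horseshoe_right {A' W X' V : C} (h : ℰ.Tri A B X) (hA : ℰ.Tri A W A')
    (hX : ℰ.Tri X V X') (h0 : ℰ.ExtVanish X W) :
    ∃ Z, ℰ.Tri A' Z X' ∧ ℰ.Tri B (W ⊞ V) Z := by
  obtain ⟨M, h1, h2⟩ := h.pushout hA
  obtain ⟨e⟩ := h2.iso_biprod h0
  obtain ⟨Z, h3, h4⟩ := (h1.of_iso (Iso.refl _) (e ≪≫ biprod.braiding _ _)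
    (Iso.refl _)).comp_inflation (hX.biprod_left W)
  exact ⟨Z, h4, h3.of_iso (Iso.refl _) (biprod.braiding _ _) (Iso.refl _)⟩

end Horseshoe

section Subcategory

variable {ω : ObjectProperty C} {X Y : C}

theorem _root_.Extri.IsSubcategory.left (hω : IsSubcategory ω) {A B : C} (e : X ≅ A ⊞ B)
    (h : ω X) : ω A :=
  hω.summand (hω.iso e h)

theorem _root_.Extri.IsSubcategory.right (hω : IsSubcategory ω) {A B : C} (e : X ≅ A ⊞ B)
    (h : ω X) : ω B :=
  hω.summand (hω.iso (e ≪≫ biprod.braiding A B) h)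

theorem IsConflation.tgt_mem_of_lift {A B : C} (hω : IsSubcategory ω) {x : A ⟶ B} {y : B ⟶ X}
    (h : ℰ.IsConflation x y) {s : X ⟶ B} (hs : s ≫ y = 𝟙 X) (hB : ω B) : ω X := by
  obtain ⟨δ, h⟩ := h
  have h0 : δ = 0 := by rw [← pull_id ℰ.E δ, ← hs, h.pull_eq_zero_of_lift]
  subst h0
  obtain ⟨e⟩ := h.iso_of_eq (ℰ.realizes_zero A X)
  exact hω.right e hB

end Subcategory

section ProperRes

variable [ℰ.EnoughProj] {ω : ObjectProperty C} {A B X : C}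

theorem rightPerp.of_retract {A B : C} (h : ℰ.rightPerp ω B) (i : A ⟶ B) (p : B ⟶ A)
    (hip : i ≫ p = 𝟙 A) : ℰ.rightPerp ω A := fun X hX j =>
  HigherVanish.of_retract_right (h X hX j) i p hip

theorem Tri.rightPerp (h : ℰ.Tri A B X) (hA : ℰ.rightPerp ω A) (hX : ℰ.rightPerp ω X) :
    ℰ.rightPerp ω B := fun Z hZ =>
  h.orth_right (hA Z hZ) (hX Z hZ)

theorem Tri.rightPerp_cone [ℰ.EnoughInj] (h : ℰ.Tri A B X) (hA : ℰ.rightPerp ω A)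
    (hB : ℰ.rightPerp ω B) : ℰ.rightPerp ω X := fun Z hZ =>
  h.orth_cone_right (hA Z hZ) (hB Z hZ)

/-- Reduces every closure property of `properRes` to one resolution step that stays within `P`. -/
theorem properRes_coinduction {P : ObjectProperty C} (hP : P ≤ ℰ.rightPerp ω)
    (h : ∀ A, P A → ∃ K W, P K ∧ ω W ∧ ℰ.Tri K W A) : P ≤ ℰ.properRes ω := by
  intro A hA
  choose k t hk ht htri using h
  let s : ℕ → {A : C // P A} := fun n =>
    Nat.rec ⟨A, hA⟩ (fun _ B => ⟨k B.1 B.2, hk B.1 B.2⟩) n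
  exact ⟨fun n => (s n).1, fun n => t (s n).1 (s n).2, rfl, fun n =>
    ⟨ht _ _, hP _ (s n).2, htri (s n).1 (s n).2⟩⟩

theorem properRes_le : ℰ.properRes ω ≤ ℰ.rightPerp ω := by
  rintro A ⟨K, W, rfl, h⟩
  exact (h 0).2.1

theorem properRes.exists_tri (h : ℰ.properRes ω A) :
    ∃ K W, ℰ.properRes ω K ∧ ω W ∧ ℰ.Tri K W A := by
  obtain ⟨K, W, rfl, h⟩ := h
  exact ⟨K 1, W 0, ⟨fun n => K (n + 1), fun n => W (n + 1), rfl, fun n => h (n + 1)⟩,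
    (h 0).1, (h 0).2.2⟩

theorem properRes.intro {K W : C} (hA : ℰ.rightPerp ω A) (h : ℰ.Tri K W A)
    (hK : ℰ.properRes ω K) (hW : ω W) : ℰ.properRes ω A := by
  refine properRes_coinduction (P := fun X => ℰ.properRes ω X ∨ X = A) ?_ ?_ A (.inr rfl)
  · rintro X (hX | rfl)
    · exact properRes_le X hX
    · exact hA
  · rintro X (hX | rfl)
    · obtain ⟨K, W, hK, hW, h⟩ := hX.exists_tri
      exact ⟨K, W, .inl hK, hW, h⟩
    · exact ⟨K, W, .inl hK, hW, h⟩

theorem le_properRes (hω : IsSubcategory ω) (hself : ℰ.SelfOrthogonal ω) :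
    ω ≤ ℰ.properRes ω :=
  properRes_coinduction hself fun A hA =>
    ⟨_, A, hω.zero _ (isZero_zero C), hA, ℰ.tri_zero_id A (isZero_zero C)⟩

theorem Tri.properRes (hω : IsSubcategory ω) (h : ℰ.Tri A B X) (hA : ℰ.properRes ω A)
    (hX : ℰ.properRes ω X) : ℰ.properRes ω B := by
  refine properRes_coinduction
    (P := fun B => ∃ A X, ℰ.Tri A B X ∧ ℰ.properRes ω A ∧ ℰ.properRes ω X)
    ?_ ?_ B ⟨A, X, h, hA, hX⟩
  · rintro B ⟨A, X, h, hA, hX⟩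
    exact h.rightPerp (properRes_le A hA) (properRes_le X hX)
  · rintro B ⟨A, X, h, hA, hX⟩
    obtain ⟨K, W, hK, hW, h1⟩ := hA.exists_tri
    obtain ⟨L, V, hL, hV, h2⟩ := hX.exists_tri
    obtain ⟨Z, hZ, hB⟩ := h.horseshoe_left h1 h2 (properRes_le A hA V hV 0)
    exact ⟨Z, W ⊞ V, ⟨K, L, hZ, hK, hL⟩, hω.sum hW hV, hB⟩

theorem properRes_isZero (hω : IsSubcategory ω) (hself : ℰ.SelfOrthogonal ω) {Z : C}
    (hZ : IsZero Z) : ℰ.properRes ω Z :=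
  le_properRes hω hself Z (hω.zero Z hZ)

theorem properRes.of_iso (hω : IsSubcategory ω) (hself : ℰ.SelfOrthogonal ω)
    (h : ℰ.properRes ω A) (e : A ≅ B) : ℰ.properRes ω B :=
  ((ℰ.tri_id_zero A (isZero_zero C)).of_iso (Iso.refl _) e (Iso.refl _)).properRes hω h
    (properRes_isZero hω hself (isZero_zero C))

theorem properRes.biprod (hω : IsSubcategory ω) (hA : ℰ.properRes ω A) (hB : ℰ.properRes ω B) :
    ℰ.properRes ω (A ⊞ B) :=
  (ℰ.tri_split A B).properRes hω hA hB

theorem Tri.properRes_cone [ℰ.EnoughInj] (hω : IsSubcategory ω) (h : ℰ.Tri A B X)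
    (hA : ℰ.properRes ω A) (hB : ℰ.properRes ω B) : ℰ.properRes ω X := by
  obtain ⟨K, W, hK, hW, h1⟩ := hB.exists_tri
  obtain ⟨Z, h2, h3⟩ := h1.comp_deflation h
  exact properRes.intro (h.rightPerp_cone (properRes_le A hA) (properRes_le B hB)) h2
    (h3.properRes hω hK hA) hW

theorem properRes.summand (hω : IsSubcategory ω) (hself : ℰ.SelfOrthogonal ω)
    (h : ℰ.properRes ω (A ⊞ B)) : ℰ.properRes ω A := by
  -- The kernel `L` of `W → A ⊞ B → A` is an extension of `B` by `K`; adding `A` makes `L ⊞ A` an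
  -- extension of `B ⊞ A` by `K`, so `L` is again such a summand.
  refine properRes_coinduction (P := fun A => ∃ B, ℰ.properRes ω (A ⊞ B)) ?_ ?_ A ⟨B, h⟩
  · rintro A ⟨B, h⟩
    exact rightPerp.of_retract (properRes_le _ h) biprod.inl biprod.fst (by simp)
  · rintro A ⟨B, h⟩
    obtain ⟨K, W, hK, hW, h1⟩ := h.exists_tri
    obtain ⟨L, h2, h3⟩ := h1.comp_deflation ((ℰ.tri_split B A).of_iso (Iso.refl _)
      (biprod.braiding B A) (Iso.refl _))
    exact ⟨L, W, ⟨A, (h3.biprod_right A).properRes hω hK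
      (h.of_iso hω hself (biprod.braiding A B))⟩, hW, h2⟩

theorem isSubcategory_properRes (hω : IsSubcategory ω) (hself : ℰ.SelfOrthogonal ω) :
    IsSubcategory (ℰ.properRes ω) where
  zero _ hZ := properRes_isZero hω hself hZ
  iso e h := h.of_iso hω hself e
  sum hX hY := hX.biprod hω hY
  summand h := h.summand hω hself

/-- The first step of the resolution of a relative projective splits. -/
theorem projIn_properRes_le (hω : IsSubcategory ω) (hself : ℰ.SelfOrthogonal ω) :
    ℰ.projIn (ℰ.properRes ω) ≤ ω := by
  rintro P ⟨hP, hP'⟩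
  obtain ⟨K, W, hK, hW, x, y, h⟩ := hP.exists_tri
  obtain ⟨s, hs⟩ := hP' x y ⟨hK, le_properRes hω hself W hW, hP, h⟩ (𝟙 P)
  exact h.tgt_mem_of_lift hω hs hW

theorem le_projIn_properRes (hω : IsSubcategory ω) (hself : ℰ.SelfOrthogonal ω) :
    ω ≤ ℰ.projIn (ℰ.properRes ω) := by
  refine fun P hP => ⟨le_properRes hω hself P hP, ?_⟩
  rintro A B X x y ⟨hA, -, -, δ, h⟩ c
  exact h.exists_lift c (properRes_le A hA P hP 0 _)

end ProperRes

section RelativeDimension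

variable [ℰ.EnoughProj] {ω 𝒴 : ObjectProperty C} {A B X : C} {n : ℕ}

variable (ℰ) in
/-- The objects `A` with `Eⁱ(A, Y) = 0` for all `i > n` and all `Y ∈ 𝒴`. -/
def relDimLE (𝒴 : ObjectProperty C) (n : ℕ) : ObjectProperty C := fun A =>
  ∀ Y, 𝒴 Y → ∀ i, n ≤ i → ℰ.HigherVanish i A Y

theorem relDimLE.mono {m : ℕ} (h : ℰ.relDimLE 𝒴 n A) (hnm : n ≤ m) : ℰ.relDimLE 𝒴 m A :=
  fun Y hY i hi => h Y hY i (hnm.trans hi)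

theorem relDimLE_zero_of_mem {A : C} (hA : ω A) : ℰ.relDimLE (ℰ.rightPerp ω) 0 A :=
  fun _ hY i _ => hY A hA i

variable [ℰ.EnoughInj]

theorem relDimLE.of_retract (h : ℰ.relDimLE 𝒴 n B) (i : A ⟶ B) (p : B ⟶ A)
    (hip : i ≫ p = 𝟙 A) : ℰ.relDimLE 𝒴 n A := fun Y hY j hj =>
  (h Y hY j hj).of_retract_left i p hip

theorem Tri.relDimLE (h : ℰ.Tri A B X) (hA : ℰ.relDimLE 𝒴 n A) (hX : ℰ.relDimLE 𝒴 n X) :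
    ℰ.relDimLE 𝒴 n B := fun Y hY i hi =>
  h.higherVanish_left (hA Y hY i hi) (hX Y hY i hi)

theorem Tri.relDimLE_cocone (h : ℰ.Tri A B X) (hB : ℰ.relDimLE 𝒴 n B)
    (hX : ℰ.relDimLE 𝒴 (n + 1) X) : ℰ.relDimLE 𝒴 n A := fun Y hY i hi =>
  h.higherVanish_cocone_left (hB Y hY i hi) (hX Y hY (i + 1) (by lia))

theorem Tri.relDimLE_cone (h : ℰ.Tri A B X) (hA : ℰ.relDimLE 𝒴 n A)
    (hB : ℰ.relDimLE 𝒴 (n + 1) B) : ℰ.relDimLE 𝒴 (n + 1) X := fun Y hY i hi => by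
  obtain ⟨i, rfl⟩ : ∃ j, i = j + 1 := ⟨i - 1, by lia⟩
  exact h.higherVanish_cone_left (hA Y hY i (by lia)) (hB Y hY (i + 1) hi)

theorem hatN_le_properRes (hω : IsSubcategory ω) (hself : ℰ.SelfOrthogonal ω) (n : ℕ) :
    ℰ.hatN ω n ≤ ℰ.properRes ω := by
  induction n with
  | zero => exact le_properRes hω hself
  | succ n ih =>
    rintro A ⟨K, W, g, f, hK, hW, h⟩
    exact h.tri.properRes_cone hω (ih K hK) (le_properRes hω hself W hW)

theorem hat_le_properRes (hω : IsSubcategory ω) (hself : ℰ.SelfOrthogonal ω) :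
    ℰ.hat ω ≤ ℰ.properRes ω := fun A ⟨n, h⟩ =>
  hatN_le_properRes hω hself n A h

theorem hatN_le_relDimLE (n : ℕ) : ℰ.hatN ω n ≤ ℰ.relDimLE (ℰ.properRes ω) n := by
  induction n with
  | zero => exact fun A hA Y hY => relDimLE_zero_of_mem hA Y (properRes_le Y hY)
  | succ n ih =>
    rintro A ⟨K, W, g, f, hK, hW, h⟩
    exact h.tri.relDimLE_cone (ih K hK) fun Y hY i _ => properRes_le Y hY W hW i

/-- Each `ω`-syzygy lowers the dimension by one; in dimension zero the syzygy conflation splits. -/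
theorem hatN_of_relDimLE (hω : IsSubcategory ω) (hA : ℰ.properRes ω A)
    (h : ℰ.relDimLE (ℰ.properRes ω) n A) : ℰ.hatN ω n A := by
  induction n generalizing A with
  | zero =>
    obtain ⟨K, W, hK, hW, h1⟩ := hA.exists_tri
    obtain ⟨e⟩ := h1.iso_biprod (h K hK 0 le_rfl)
    exact hω.right e hW
  | succ n ih =>
    obtain ⟨K, W, hK, hW, x, y, h1⟩ := hA.exists_tri
    exact ⟨K, W, x, y, ih hK (h1.tri.relDimLE_cocone
      (fun Y hY i _ => properRes_le Y hY W hW i) h), hW, h1⟩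

theorem exists_relDimLE_of_check {𝒟 : ObjectProperty C}
    (h𝒟 : ∀ A, 𝒟 A → ∃ n, ℰ.relDimLE 𝒴 n A) (hA : ℰ.check 𝒟 A) : ∃ n, ℰ.relDimLE 𝒴 n A := by
  obtain ⟨m, hA⟩ := hA
  induction m generalizing A with
  | zero => exact h𝒟 A hA
  | succ m ih =>
    obtain ⟨W, K, g, f, hW, hK, h⟩ := hA
    obtain ⟨a, ha⟩ := h𝒟 W hW
    obtain ⟨b, hb⟩ := ih hK
    exact ⟨max a b, h.tri.relDimLE_cocone (ha.mono (le_max_left _ _))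
      (hb.mono ((le_max_right a b).trans (Nat.le_succ _)))⟩

end RelativeDimension

section Check

variable {𝒯 : ObjectProperty C} {A B X : C} {n : ℕ}

theorem check_of_mem (hA : 𝒯 A) : ℰ.check 𝒯 A := ⟨0, hA⟩

theorem check.intro {W K : C} (h : ℰ.Tri A W K) (hW : 𝒯 W) (hK : ℰ.check 𝒯 K) :
    ℰ.check 𝒯 A := by
  obtain ⟨x, y, h⟩ := h
  obtain ⟨n, hK⟩ := hK
  exact ⟨n + 1, W, K, x, y, hW, hK, h⟩

theorem checkN_succ (h𝒯 : IsSubcategory 𝒯) (h : ℰ.checkN 𝒯 n A) : ℰ.checkN 𝒯 (n + 1) A := by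
  induction n generalizing A with
  | zero =>
    obtain ⟨x, y, h1⟩ := ℰ.tri_id_zero A (isZero_zero C)
    exact ⟨A, _, x, y, h, h𝒯.zero _ (isZero_zero C), h1⟩
  | succ n ih =>
    obtain ⟨W, K, g, f, hW, hK, h⟩ := h
    exact ⟨W, K, g, f, hW, ih hK, h⟩

theorem checkN_mono (h𝒯 : IsSubcategory 𝒯) {m : ℕ} (h : ℰ.checkN 𝒯 n A) (hnm : n ≤ m) :
    ℰ.checkN 𝒯 m A := by
  induction hnm with
  | refl => exact h
  | step _ ih => exact checkN_succ h𝒯 ih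

theorem checkN_of_iso (h𝒯 : IsSubcategory 𝒯) (h : ℰ.checkN 𝒯 n A) (e : A ≅ B) :
    ℰ.checkN 𝒯 n B := by
  cases n with
  | zero => exact h𝒯.iso e h
  | succ n =>
    obtain ⟨W, K, g, f, hW, hK, h⟩ := h
    obtain ⟨x, y, h'⟩ := h.tri.of_iso e (Iso.refl _) (Iso.refl _)
    exact ⟨W, K, x, y, hW, hK, h'⟩

theorem checkN_biprod (h𝒯 : IsSubcategory 𝒯) (hA : ℰ.checkN 𝒯 n A) (hB : ℰ.checkN 𝒯 n B) :
    ℰ.checkN 𝒯 n (A ⊞ B) := by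
  induction n generalizing A B with
  | zero => exact h𝒯.sum hA hB
  | succ n ih =>
    obtain ⟨W, K, g, f, hW, hK, h⟩ := hA
    obtain ⟨W', K', g', f', hW', hK', h'⟩ := hB
    obtain ⟨x, y, h''⟩ := h.tri.sum h'.tri
    exact ⟨W ⊞ W', K ⊞ K', x, y, h𝒯.sum hW hW', ih hK hK', h''⟩

theorem check.exists_tri (h𝒯 : IsSubcategory 𝒯) (h : ℰ.check 𝒯 A) :
    ∃ W K, 𝒯 W ∧ ℰ.check 𝒯 K ∧ ℰ.Tri A W K := by
  obtain ⟨n, h⟩ := h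
  obtain ⟨W, K, x, y, hW, hK, h⟩ := checkN_succ h𝒯 h
  exact ⟨W, K, hW, ⟨n, hK⟩, h.tri⟩

variable [ℰ.EnoughProj] [ℰ.EnoughInj]

theorem check.orth {T : C} (h : ℰ.check 𝒯 A) (hT : ∀ W, 𝒯 W → ℰ.Orth W T) : ℰ.Orth A T := by
  obtain ⟨n, h⟩ := h
  induction n generalizing A with
  | zero => exact hT A h
  | succ n ih =>
    obtain ⟨W, K, x, y, hW, hK, h⟩ := h
    exact h.tri.orth_cocone_left (hT W hW) (ih hK)

/-- Once both coresolutions are padded to a common length, the dual horseshoe applies at each step,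
because objects of `check 𝒯` are left orthogonal to `𝒯`. -/
theorem Tri.check (h𝒯 : IsSubcategory 𝒯) (hself : ℰ.SelfOrthogonal 𝒯) (h : ℰ.Tri A B X)
    (hA : ℰ.check 𝒯 A) (hX : ℰ.check 𝒯 X) : ℰ.check 𝒯 B := by
  obtain ⟨n, hA⟩ := hA
  obtain ⟨m, hX⟩ := hX
  replace hA := checkN_mono h𝒯 hA (le_max_left n m)
  replace hX := checkN_mono h𝒯 hX (le_max_right n m)
  generalize max n m = k at hA hX
  refine ⟨k, ?_⟩
  induction k generalizing A B X with
  | zero =>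
    obtain ⟨e⟩ := h.iso_biprod (hself A hA X hX 0)
    exact h𝒯.iso e.symm (h𝒯.sum hA hX)
  | succ k ih =>
    obtain ⟨W, K, _, _, hW, hK, h1⟩ := hA
    have hXW : ℰ.Orth X W := check.orth ⟨_, hX⟩ (hself W hW)
    obtain ⟨V, L, _, _, hV, hL, h2⟩ := hX
    obtain ⟨Z, h3, x, y, h4⟩ := h.horseshoe_right h1.tri h2.tri (hXW 0)
    exact ⟨W ⊞ V, Z, x, y, h𝒯.sum hW hV, ih h3 hK hL, h4⟩

theorem Tri.check_cocone (h𝒯 : IsSubcategory 𝒯) (hself : ℰ.SelfOrthogonal 𝒯) (h : ℰ.Tri A B X)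
    (hB : ℰ.check 𝒯 B) (hX : ℰ.check 𝒯 X) : ℰ.check 𝒯 A := by
  obtain ⟨W, K, hW, hK, h1⟩ := hB.exists_tri h𝒯
  obtain ⟨Z, h2, h3⟩ := h.comp_inflation h1
  exact check.intro h2 hW (h3.check h𝒯 hself hX hK)

theorem check.summand (h𝒯 : IsSubcategory 𝒯) (hself : ℰ.SelfOrthogonal 𝒯)
    (h : ℰ.check 𝒯 (A ⊞ B)) : ℰ.check 𝒯 A := by
  obtain ⟨n, h⟩ := h
  induction n generalizing A B with
  | zero => exact ⟨0, h𝒯.summand h⟩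
  | succ n ih =>
    have horth : ∀ W, 𝒯 W → ℰ.Orth (A ⊞ B) W := fun W hW => check.orth ⟨_, h⟩ (hself W hW)
    obtain ⟨W, K, _, _, hW, hK, h⟩ := h
    have hKW : ℰ.Orth K W := check.orth ⟨_, hK⟩ (hself W hW)
    obtain ⟨L, h1, h2⟩ := ((ℰ.tri_split A B)).comp_inflation h.tri
    obtain ⟨L', h1', h2'⟩ := ((ℰ.tri_split B A).of_iso (Iso.refl _)
      (biprod.braiding B A) (Iso.refl _)).comp_inflation h.tri
    have hL := ((h2.biprod_left A).orth_left
      ((horth W hW).of_iso_left (biprod.braiding A B)) hKW).of_biprod_left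
    have hL' := ((h2'.biprod_left B).orth_left (horth W hW) hKW).of_biprod_left
    -- Schanuel's argument: `A ⊞ B` embeds in `W ⊞ W` with cokernel `L ⊞ L'` and in `W` with
    -- cokernel `K`. Both conflations through the pushout split, so `L` is a summand of `(W ⊞ W) ⊞
    -- K`, whose coresolution is one step shorter.
    obtain ⟨M, h3, h4⟩ := (h1.sum h1').pushout h.tri
    obtain ⟨e⟩ := h3.iso_biprod (Orth.extVanish (hKW.biprod_right hKW))
    obtain ⟨e'⟩ := h4.iso_biprod (Orth.extVanish (hL.biprod_left hL'))
    have hM : ℰ.checkN 𝒯 n ((W ⊞ W) ⊞ K) :=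
      checkN_biprod h𝒯 (checkN_mono (n := 0) h𝒯 (h𝒯.sum hW hW) (Nat.zero_le n)) hK
    exact check.intro h1 hW (ih (checkN_of_iso h𝒯 hM
      (e.symm ≪≫ e' ≪≫ biprod.braiding _ _ ≪≫ biprod.associator _ _ _)))

end Check

end ExtriangulatedStructure

end Extri

/-! ### From tilting subcategories to resolving subcategories -/

namespace Extri

section FiniteSums

variable {C : Type u} [Category.{v} C] [Preadditive C] [HasFiniteBiproducts C]

/-- Any summand of a finite biproduct splits off. -/
noncomputable def biproductSuccAboveIso {n : ℕ} (f : Fin (n + 1) → C) (p : Fin (n + 1)) :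
    (⨁ f) ≅ f p ⊞ ⨁ (fun i : Fin n => f (p.succAbove i)) where
  hom := biprod.lift (biproduct.π f p) (biproduct.lift fun i => biproduct.π f (p.succAbove i))
  inv := biprod.desc (biproduct.ι f p) (biproduct.desc fun i => biproduct.ι f (p.succAbove i))
  hom_inv_id := by
    rw [biprod.lift_desc, biproduct.lift_desc, ← biproduct.total, Fin.sum_univ_succAbove _ p]
  inv_hom_id := by
    apply biprod.hom_ext'
    · apply biprod.hom_ext
      · simp
      · apply biproduct.hom_ext
        intro i
        simp [biproduct.ι_π_ne _ (Fin.succAbove_ne p i).symm]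
    · apply biproduct.hom_ext'
      intro i
      apply biprod.hom_ext
      · simp [biproduct.ι_π_ne _ (Fin.succAbove_ne p i)]
      · apply biproduct.hom_ext
        intro j
        by_cases hij : i = j
        · subst hij; simp
        · simp [biproduct.ι_π_ne _ hij,
            biproduct.ι_π_ne f (fun h => hij (Fin.succAbove_right_injective h))]

theorem isZero_biproduct_fin_zero (f : Fin 0 → C) : IsZero (⨁ f) := by
  rw [IsZero.iff_id_eq_zero]
  exact biproduct.hom_ext _ _ fun i => i.elim0

/-- `(X ⊞ X') ⊞ (Y ⊞ Y') ≅ (X ⊞ Y) ⊞ (X' ⊞ Y')` -/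
noncomputable def biprodInterchange (X X' Y Y' : C) :
    (X ⊞ X') ⊞ (Y ⊞ Y') ≅ (X ⊞ Y) ⊞ (X' ⊞ Y') where
  hom := biprod.lift (biprod.map biprod.fst biprod.fst) (biprod.map biprod.snd biprod.snd)
  inv := biprod.lift (biprod.map biprod.fst biprod.fst) (biprod.map biprod.snd biprod.snd)

theorem exists_biproduct_add (T : C) (n m : ℕ) :
    ∃ k, Nonempty ((⨁ fun _ : Fin n => T) ⊞ (⨁ fun _ : Fin m => T) ≅ ⨁ fun _ : Fin k => T) := by
  induction n with
  | zero =>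
    exact ⟨m, ⟨biprod.braiding _ _ ≪≫ ExtriangulatedStructure.biprodIsZeroIso _
      (isZero_biproduct_fin_zero _)⟩⟩
  | succ n ih =>
    obtain ⟨k, ⟨e⟩⟩ := ih
    exact ⟨k + 1, ⟨biprod.mapIso (biproductSuccAboveIso _ 0) (Iso.refl _) ≪≫ biprod.associator _ _ _ ≪≫
      biprod.mapIso (Iso.refl _) e ≪≫ (biproductSuccAboveIso (n := k) (fun _ => T) 0).symm⟩⟩

theorem IsSubcategory.biproduct {ω : ObjectProperty C} (hω : IsSubcategory ω) {n : ℕ}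
    (f : Fin n → C) (hf : ∀ i, ω (f i)) : ω (⨁ f) := by
  induction n with
  | zero => exact hω.zero _ (isZero_biproduct_fin_zero f)
  | succ n ih =>
    exact hω.iso (biproductSuccAboveIso f 0).symm (hω.sum (hf 0) (ih _ fun i => hf _))

theorem isSubcategory_add (T : C) : IsSubcategory (add T) where
  zero Z hZ := ⟨0, Z, ⟨(((ExtriangulatedStructure.biprodIsZeroIso Z hZ)).trans
    (hZ.iso (isZero_biproduct_fin_zero _)))⟩⟩
  iso := fun e ⟨n, Y, ⟨e'⟩⟩ => ⟨n, Y, ⟨biprod.mapIso e.symm (Iso.refl _) ≪≫ e'⟩⟩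
  sum := fun {X X'} ⟨n, Y, ⟨e⟩⟩ ⟨m, Y', ⟨e'⟩⟩ => by
    obtain ⟨k, ⟨f⟩⟩ := exists_biproduct_add T n m
    exact ⟨k, Y ⊞ Y', ⟨biprodInterchange X X' Y Y' ≪≫ biprod.mapIso e e' ≪≫ f⟩⟩
  summand := fun {X Y} ⟨n, Z, ⟨e⟩⟩ => ⟨n, Y ⊞ Z, ⟨(biprod.associator X Y Z).symm ≪≫ e⟩⟩

theorem self_mem_add (T : C) : add T T :=
  ⟨1, _, ⟨(biproductSuccAboveIso (n := 0) (fun _ => T) 0).symm⟩⟩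

theorem IsSubcategory.add_le {ω : ObjectProperty C} (hω : IsSubcategory ω) {T : C} (hT : ω T) :
    add T ≤ ω := fun _ ⟨_, _, ⟨e⟩⟩ =>
  hω.left e.symm (hω.biproduct _ fun _ => hT)

end FiniteSums

namespace ExtriangulatedStructure

variable {C : Type u} [Category.{v} C] [Preadditive C] [HasFiniteBiproducts C]
variable {ℰ : ExtriangulatedStructure.{w} C}

theorem stronglyContravariantlyFiniteIn_of_tri {𝒟 𝒴 : ObjectProperty C} (h𝒟 : 𝒟 ≤ 𝒴)
    (h : ∀ X, 𝒴 X → ∃ K W, ℰ.Tri K W X ∧ 𝒟 W ∧ 𝒴 K ∧ ∀ V, 𝒟 V → ℰ.ExtVanish V K) :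
    ℰ.StronglyContravariantlyFiniteIn 𝒟 𝒴 := by
  intro X hX
  obtain ⟨K, W, ⟨k, g, δ, h1⟩, hW, hK, hvan⟩ := h X hX
  exact ⟨K, W, k, g, ⟨hK, h𝒟 W hW, hX, δ, h1⟩, hW, fun V g' hV =>
    h1.exists_lift g' (hvan V hV _)⟩

variable [ℰ.EnoughProj] [ℰ.EnoughInj]

theorem isSubcategory_relDimLE (𝒴 : ObjectProperty C) (n : ℕ) :
    IsSubcategory (ℰ.relDimLE 𝒴 n) where
  zero _ hZ Y _ i _ := Orth.of_isZero_left hZ Y i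
  iso e h := h.of_retract e.inv e.hom (by simp)
  sum {X Y} hX hY := (ℰ.tri_split X Y).relDimLE hX hY
  summand h := h.of_retract biprod.inl biprod.fst (by simp)

theorem isSubcategory_check {𝒯 : ObjectProperty C} (h𝒯 : IsSubcategory 𝒯)
    (hself : ℰ.SelfOrthogonal 𝒯) : IsSubcategory (ℰ.check 𝒯) where
  zero Z hZ := ⟨0, h𝒯.zero Z hZ⟩
  iso e := fun ⟨n, h⟩ => ⟨n, checkN_of_iso h𝒯 h e⟩
  sum {X Y} hX hY := (ℰ.tri_split X Y).check h𝒯 hself hX hY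
  summand h := h.summand h𝒯 hself

section Tilting

variable {𝒞 𝒯 : ObjectProperty C}

theorem IsTilting.le_properRes (h𝒞 : IsSubcategory 𝒞) (h : ℰ.IsTilting 𝒞 𝒯) :
    𝒯 ≤ ℰ.properRes 𝒞 :=
  h.le_hat.trans (hat_le_properRes h𝒞 h.selfOrthogonal_left)

theorem IsTilting.exists_relDimLE (h : ℰ.IsTilting 𝒞 𝒯) (hfin : IsFiniteSubcategory 𝒯) :
    ∃ n, 𝒯 ≤ ℰ.relDimLE (ℰ.properRes 𝒞) n := by
  obtain ⟨T, rfl⟩ := hfin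
  obtain ⟨n, hn⟩ := h.le_hat T (self_mem_add T)
  exact ⟨n, (isSubcategory_relDimLE _ n).add_le (hatN_le_relDimLE n T hn)⟩

theorem Tri.exists_pushout_check (h𝒯 : IsSubcategory 𝒯) (hself : ℰ.SelfOrthogonal 𝒯)
    {K W X K' Z : C} (h : ℰ.Tri K W X) (hW : ℰ.check 𝒯 W) (h' : ℰ.Tri K K' Z)
    (hZ : ℰ.check 𝒯 Z) : ∃ P, ℰ.check 𝒯 P ∧ ℰ.Tri K' P X := by
  obtain ⟨P, h1, h2⟩ := h.pushout h'
  exact ⟨P, h1.check h𝒯 hself hW hZ, h2⟩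

/-- Each increase of `k` kills one more degree. Treat the `𝒞`-syzygy of `X` first, push out, and
embed the result into an object `T` of `𝒯`; then `X'` is the cokernel of `K' → T`, and dimension
shifting lowers the degree by one. -/
theorem IsTilting.exists_tri_vanishing (h𝒞 : IsSubcategory 𝒞) (h𝒯 : IsSubcategory 𝒯)
    (h : ℰ.IsTilting 𝒞 𝒯) {n : ℕ} (hn : 𝒯 ≤ ℰ.relDimLE (ℰ.properRes 𝒞) n) (k : ℕ) {X : C}
    (hX : ℰ.properRes 𝒞 X) :
    ∃ X' Z, ℰ.Tri X X' Z ∧ ℰ.check 𝒯 Z ∧ ℰ.properRes 𝒞 X' ∧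
      ∀ W, 𝒯 W → ∀ i, n ≤ i + k → ℰ.HigherVanish i W X' := by
  induction k generalizing X with
  | zero =>
    exact ⟨X, _, ℰ.tri_id_zero X (isZero_zero C), ⟨0, h𝒯.zero _ (isZero_zero C)⟩, hX,
      fun W hW i hi => hn W hW X hX i hi⟩
  | succ k ih =>
    obtain ⟨K, W, hK, hW, h1⟩ := hX.exists_tri
    obtain ⟨K', Z, h2, hZ, hK', hvan⟩ := ih hK
    obtain ⟨P, hP, h3⟩ := h1.exists_pushout_check h𝒯 h.selfOrthogonal_right (h.le_check W hW) h2 hZ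
    obtain ⟨T, P', hT, hP', h4⟩ := hP.exists_tri h𝒯
    obtain ⟨X', h5, h6⟩ := h3.comp_inflation h4
    refine ⟨X', P', h6, hP', h5.properRes_cone h𝒞 hK' (h.le_properRes h𝒞 T hT), ?_⟩
    exact fun V hV i hi => h5.higherVanish_cone_right (h.selfOrthogonal_right T hT V hV i)
      (hvan V hV (i + 1) (by lia))

theorem IsTilting.exists_tri_approx (h𝒞 : IsSubcategory 𝒞) (h𝒯 : IsSubcategory 𝒯)
    (h : ℰ.IsTilting 𝒞 𝒯) (hfin : IsFiniteSubcategory 𝒯) {X : C} (hX : ℰ.properRes 𝒞 X) :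
    ∃ K W, ℰ.Tri K W X ∧ ℰ.check 𝒯 W ∧ ℰ.properRes 𝒞 K ∧ ℰ.rightPerp 𝒯 K := by
  obtain ⟨n, hn⟩ := h.exists_relDimLE hfin
  obtain ⟨K, W, hK, hW, h1⟩ := hX.exists_tri
  -- With `k = n` the condition `n ≤ i + k` always holds, so `K'` lies in `𝒯^⊥`.
  obtain ⟨K', Z, h2, hZ, hK', hvan⟩ := h.exists_tri_vanishing h𝒞 h𝒯 hn n hK
  obtain ⟨P, hP, h3⟩ := h1.exists_pushout_check h𝒯 h.selfOrthogonal_right (h.le_check W hW) h2 hZ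
  exact ⟨K', P, h3, hP, hK', fun V hV i => hvan V hV i (by lia)⟩

theorem exists_relDimLE_of_hat {ω : ObjectProperty C} {A : C} (h : ℰ.hat ω A) :
    ∃ n, ℰ.relDimLE (ℰ.properRes ω) n A := by
  obtain ⟨n, h⟩ := h
  exact ⟨n, hatN_le_relDimLE n A h⟩

theorem IsTilting.check_inf_properRes_le_hat (h𝒞 : IsSubcategory 𝒞) (h : ℰ.IsTilting 𝒞 𝒯) :
    ℰ.check 𝒯 ⊓ ℰ.properRes 𝒞 ≤ ℰ.hat 𝒞 := fun X ⟨hX, hX'⟩ => by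
  obtain ⟨n, hn⟩ := exists_relDimLE_of_check
    (fun A hA => exists_relDimLE_of_hat (h.le_hat A hA)) hX
  exact ⟨n, hatN_of_relDimLE h𝒞 hX' hn⟩

theorem IsTilting.isRelResolving (h𝒞 : IsSubcategory 𝒞) (h𝒯 : IsSubcategory 𝒯)
    (h : ℰ.IsTilting 𝒞 𝒯) :
    ℰ.IsRelResolving (ℰ.check 𝒯 ⊓ ℰ.properRes 𝒞) (ℰ.properRes 𝒞) where
  le := inf_le_right
  extension _ _ hxy hA hX :=
    ⟨hxy.2.2.2.tri.check h𝒯 h.selfOrthogonal_right hA.1 hX.1, hxy.2.1⟩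
  summand hAB := ⟨hAB.1.summand h𝒯 h.selfOrthogonal_right,
    hAB.2.summand h𝒞 h.selfOrthogonal_left⟩
  cocone _ _ hxy hB hX :=
    ⟨hxy.2.2.2.tri.check_cocone h𝒯 h.selfOrthogonal_right hB.1 hX.1, hxy.1⟩
  proj_le P hP := ⟨h.le_check P (projIn_properRes_le h𝒞 h.selfOrthogonal_left P hP), hP.1⟩

theorem IsTilting.stronglyContravariantlyFiniteIn (h𝒞 : IsSubcategory 𝒞)
    (h𝒯 : IsSubcategory 𝒯) (h : ℰ.IsTilting 𝒞 𝒯) (hfin : IsFiniteSubcategory 𝒯) :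
    ℰ.StronglyContravariantlyFiniteIn (ℰ.check 𝒯 ⊓ ℰ.properRes 𝒞) (ℰ.properRes 𝒞) := by
  refine stronglyContravariantlyFiniteIn_of_tri inf_le_right fun X hX => ?_
  obtain ⟨K, W, h1, hW, hK, hK'⟩ := h.exists_tri_approx h𝒞 h𝒯 hfin hX
  exact ⟨K, W, h1, ⟨hW, h1.properRes h𝒞 hK hX⟩, hK, fun V hV => (hV.1.orth hK').extVanish⟩

theorem isSubcategory_inf {ω ω' : ObjectProperty C} (h : IsSubcategory ω)
    (h' : IsSubcategory ω') : IsSubcategory (ω ⊓ ω') where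
  zero Z hZ := ⟨h.zero Z hZ, h'.zero Z hZ⟩
  iso e hX := ⟨h.iso e hX.1, h'.iso e hX.2⟩
  sum hX hY := ⟨h.sum hX.1 hY.1, h'.sum hX.2 hY.2⟩
  summand hX := ⟨h.summand hX.1, h'.summand hX.2⟩

/-- A tilting subcategory consists of the relative injectives of `𝒯̌ ∩ _𝒞𝒳`. -/
theorem IsTilting.mem_iff (h𝒞 : IsSubcategory 𝒞) (h𝒯 : IsSubcategory 𝒯) (h : ℰ.IsTilting 𝒞 𝒯)
    (X : C) : 𝒯 X ↔ (ℰ.check 𝒯 ⊓ ℰ.properRes 𝒞) X ∧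
      ∀ V, (ℰ.check 𝒯 ⊓ ℰ.properRes 𝒞) V → ℰ.ExtVanish V X := by
  constructor
  · intro hX
    exact ⟨⟨check_of_mem hX, h.le_properRes h𝒞 X hX⟩, fun V hV =>
      (hV.1.orth (h.selfOrthogonal_right X hX)).extVanish⟩
  · rintro ⟨⟨hX, hX'⟩, hvan⟩
    obtain ⟨T, K, hT, hK, h1⟩ := hX.exists_tri h𝒯
    obtain ⟨e⟩ := h1.iso_biprod (hvan K ⟨hK, h1.properRes_cone h𝒞 hX' (h.le_properRes h𝒞 T hT)⟩)
    exact h𝒯.left e hT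

end Tilting

end ExtriangulatedStructure

end Extri

/-! ### Krull–Schmidt arguments, minimal approximations and Wakamatsu's lemma -/

namespace Extri

section Radical

variable {C : Type u} [Category.{v} C] [Preadditive C]

theorem isIso_id_sub_comp_comm {A B : C} (p : A ⟶ B) (q : B ⟶ A) [IsIso (𝟙 B - q ≫ p)] :
    IsIso (𝟙 A - p ≫ q) := by
  have h1 : (q ≫ p) ≫ inv (𝟙 B - q ≫ p) = inv (𝟙 B - q ≫ p) - 𝟙 B := by
    have := IsIso.hom_inv_id (𝟙 B - q ≫ p)
    rw [Preadditive.sub_comp, Category.id_comp] at this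
    rw [eq_sub_iff_add_eq, add_comm]
    exact (sub_eq_iff_eq_add.1 this).symm
  have h2 : inv (𝟙 B - q ≫ p) ≫ q ≫ p = inv (𝟙 B - q ≫ p) - 𝟙 B := by
    have := IsIso.inv_hom_id (𝟙 B - q ≫ p)
    rw [Preadditive.comp_sub, Category.comp_id] at this
    rw [eq_sub_iff_add_eq, add_comm]
    exact (sub_eq_iff_eq_add.1 this).symm
  rw [Category.assoc] at h1
  refine ⟨𝟙 A + p ≫ inv (𝟙 B - q ≫ p) ≫ q, ?_, ?_⟩
  · simp only [Preadditive.sub_comp, Preadditive.comp_add, Category.id_comp, Category.comp_id,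
      Category.assoc]
    rw [reassoc_of% h1]
    simp only [Preadditive.sub_comp, Preadditive.comp_sub, Category.id_comp]
    abel
  · simp only [Preadditive.add_comp, Preadditive.comp_sub, Category.id_comp, Category.comp_id,
      Category.assoc]
    rw [reassoc_of% h2]
    simp only [Preadditive.sub_comp, Preadditive.comp_sub, Category.id_comp]
    abel

/-- A non-isomorphism between objects with local endomorphism rings is radical. -/
theorem isIso_id_sub_comp_of_not_isIso {A B : C} [IsLocalRing (End A)] [IsLocalRing (End B)]
    (a : A ⟶ B) (ha : ¬ IsIso a) (c : B ⟶ A) : IsIso (𝟙 A - a ≫ c) := by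
  let u : End A := a ≫ c
  let u' : End A := 𝟙 A - a ≫ c
  have hsum : u + u' = 1 := by
    change a ≫ c + (𝟙 A - a ≫ c) = 𝟙 A
    abel
  rcases IsLocalRing.isUnit_or_isUnit_of_add_one hsum with h | h
  · exfalso
    have : IsIso (a ≫ c) := (isUnit_iff_isIso _).1 h
    have hac : a ≫ c ≫ inv (a ≫ c) = 𝟙 A := by rw [← Category.assoc, IsIso.hom_inv_id]
    obtain ⟨ρ, hρ⟩ : ∃ ρ : B ⟶ A, a ≫ ρ = 𝟙 A := ⟨_, hac⟩
    let v : End B := ρ ≫ a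
    let v' : End B := 𝟙 B - ρ ≫ a
    have hsum' : v + v' = 1 := by
      change ρ ≫ a + (𝟙 B - ρ ≫ a) = 𝟙 B
      abel
    rcases IsLocalRing.isUnit_or_isUnit_of_add_one hsum' with h' | h'
    · have : IsIso (ρ ≫ a) := (isUnit_iff_isIso _).1 h'
      refine ha ⟨ρ, hρ, ?_⟩
      rw [← cancel_epi (ρ ≫ a), Category.assoc, reassoc_of% hρ, Category.comp_id]
    · have : IsIso (𝟙 B - ρ ≫ a) := (isUnit_iff_isIso _).1 h'
      have h0 : a ≫ (𝟙 B - ρ ≫ a) = 0 := by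
        rw [Preadditive.comp_sub, reassoc_of% hρ]; simp
      have h1 : a = 0 := by
        rw [← cancel_mono (𝟙 B - ρ ≫ a), h0, zero_comp]
      have h2 : (1 : End A) = 0 := by
        change 𝟙 A = 0
        rw [← hρ, h1, zero_comp]
      exact one_ne_zero h2
  · exact (isUnit_iff_isIso _).1 h

theorem isIso_id_sub_of_forall_not_isIso [HasFiniteBiproducts C] {n : ℕ} (f : Fin n → C)
    (hf : ∀ i, IsLocalRing (End (f i))) (r : (⨁ f) ⟶ ⨁ f)
    (hr : ∀ i j, ¬ IsIso (biproduct.ι f i ≫ r ≫ biproduct.π f j)) : IsIso (𝟙 (⨁ f) - r) := by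
  -- `P` describes the Jacobson radical of the endomorphism ring. It is additive, so it can be
  -- checked on the matrix entries of `r`.
  let P : ((⨁ f) ⟶ ⨁ f) → Prop := fun x => ∀ y, IsIso (𝟙 (⨁ f) - x ≫ y)
  have hadd : ∀ x x', P x → P x' → P (x + x') := by
    intro x x' hx hx' y
    have := hx y
    have := hx' (y ≫ inv (𝟙 (⨁ f) - x ≫ y))
    have heq : 𝟙 (⨁ f) - (x + x') ≫ y =
        (𝟙 (⨁ f) - x' ≫ y ≫ inv (𝟙 (⨁ f) - x ≫ y)) ≫ (𝟙 (⨁ f) - x ≫ y) := by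
      rw [Preadditive.sub_comp, Category.assoc, Category.assoc, IsIso.inv_hom_id,
        Preadditive.add_comp]
      simp only [Category.id_comp, Category.comp_id]
      abel
    rw [heq]
    infer_instance
  have hzero : P 0 := fun y => by simpa using (inferInstance : IsIso (𝟙 (⨁ f)))
  have hr' : r = ∑ i, ∑ j,
      biproduct.π f i ≫ (biproduct.ι f i ≫ r ≫ biproduct.π f j) ≫ biproduct.ι f j := by
    have h1 : r = (∑ i, biproduct.π f i ≫ biproduct.ι f i) ≫ r ≫
        (∑ j, biproduct.π f j ≫ biproduct.ι f j) := by
      rw [biproduct.total]; simp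
    conv_lhs => rw [h1]
    simp only [Preadditive.sum_comp, Preadditive.comp_sum, Category.assoc]
    rw [Finset.sum_comm]
  have hP : P r := by
    rw [hr']
    refine Finset.sum_induction _ P hadd hzero fun i _ =>
      Finset.sum_induction _ P hadd hzero fun j _ y => ?_
    have := hf i
    have := hf j
    have := isIso_id_sub_comp_of_not_isIso _ (hr i j) (biproduct.ι f j ≫ y ≫ biproduct.π f i)
    have : IsIso (𝟙 (f i) - ((biproduct.ι f i ≫ r ≫ biproduct.π f j) ≫ biproduct.ι f j ≫ y) ≫
        biproduct.π f i) := by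
      simpa only [Category.assoc] using this
    have := isIso_id_sub_comp_comm (biproduct.π f i)
      ((biproduct.ι f i ≫ r ≫ biproduct.π f j) ≫ biproduct.ι f j ≫ y)
    simpa only [Category.assoc] using this
  simpa using hP (𝟙 _)

/-- A morphism `A' ⟶ W ≅ A ⊞ W'` whose component in `A` is invertible can replace `A`. -/
theorem exists_iso_biprod_of_isIso [HasFiniteBiproducts C] {A A' W W' : C} (e : W ≅ A ⊞ W')
    (φ : A' ⟶ W) (hφ : IsIso (φ ≫ e.hom ≫ biprod.fst)) :
    ∃ t : A' ⊞ W' ≅ W, biprod.inl ≫ t.hom = φ := by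
  let θ := asIso (φ ≫ e.hom ≫ biprod.fst)
  have hθ : φ ≫ e.hom ≫ biprod.fst = θ.hom := rfl
  let t : A' ⊞ W' ≅ A ⊞ W' :=
    { hom := biprod.desc (φ ≫ e.hom) biprod.inr
      inv := biprod.desc (θ.inv ≫ biprod.lift (𝟙 A') (-(φ ≫ e.hom ≫ biprod.snd))) biprod.inr
      hom_inv_id := by
        apply biprod.hom_ext'
        · have h1 : φ ≫ e.hom = biprod.lift θ.hom (φ ≫ e.hom ≫ biprod.snd) := by
            apply biprod.hom_ext <;> simp [hθ]
          apply biprod.hom_ext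
          · simp [h1]
          · simp [h1]
        · simp
      inv_hom_id := by
        apply biprod.hom_ext'
        · apply biprod.hom_ext
          · simp [hθ]
          · simp
        · simp }
  exact ⟨t ≪≫ e.symm, by simp [t]⟩

end Radical

namespace ExtriangulatedStructure

variable {C : Type u} [Category.{v} C] [Preadditive C] [HasFiniteBiproducts C]
variable {ℰ : ExtriangulatedStructure.{w} C}

/-- Two conflations with the same deflation have isomorphic kernels. -/
theorem Realizes.kernel_iso {A A' B X : C} {x : A ⟶ B} {x' : A' ⟶ B} {y : B ⟶ X}
    {δ : Extn ℰ.E X A} {δ' : Extn ℰ.E X A'} (h : ℰ.Realizes x y δ) (h' : ℰ.Realizes x' y δ') :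
    Nonempty (A ≅ A') := by
  obtain ⟨a, hx, hδ⟩ := ℰ.et3_op h h' (𝟙 B) (𝟙 X) (by simp)
  rw [Category.comp_id] at hx
  rw [pull_id] at hδ
  -- Inflations need not be monic, so kernels have no universal property; instead `a` is shown to be
  -- epic and split monic.
  have hinj : ∀ {Z : C} (u : A' ⟶ Z), a ≫ u = 0 → u = 0 := by
    intro Z u hu
    obtain ⟨v, rfl⟩ := h'.exists_extend u (by rw [← hδ, ← push_comp, hu, push_zero_hom])
    obtain ⟨c, rfl⟩ := h.exists_desc_cokernel v (by rw [hx, Category.assoc, hu])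
    rw [← Category.assoc, h'.comp_eq_zero, zero_comp]
  obtain ⟨u, hu⟩ := h'.exists_push_eq δ h.pull_eq_zero
  obtain ⟨v, hv⟩ := h.exists_extend (𝟙 A - a ≫ u) (by
    have h1 : push ℰ.E (𝟙 A - a ≫ u) δ + push ℰ.E (a ≫ u) δ = push ℰ.E (𝟙 A) δ := by
      have := ℰ.additive_right (op X)
      simp [push]
    rw [push_comp, hδ, hu, push_id] at h1
    simpa using h1)
  have hr : a ≫ (u + x' ≫ v) = 𝟙 A := by
    rw [Preadditive.comp_add, ← Category.assoc a x', ← hx, hv]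
    abel
  refine ⟨⟨a, u + x' ≫ v, hr, ?_⟩⟩
  rw [← sub_eq_zero]
  apply hinj
  rw [Preadditive.comp_sub, reassoc_of% hr]
  simp

/-- The kernel of a right minimal approximation is relatively injective (Wakamatsu's lemma). -/
theorem Realizes.extVanish_of_minimal {𝒟 : ObjectProperty C} {K W X : C} {k : K ⟶ W} {g : W ⟶ X}
    {δ : Extn ℰ.E X K} (h : ℰ.Realizes k g δ) (hg : IsRightApprox 𝒟 g)
    (hmin : ∀ t : W ⟶ W, t ≫ g = g → IsIso t)
    (hext : ∀ V N, 𝒟 V → ℰ.Tri W N V → 𝒟 N) {V : C} (hV : 𝒟 V) : ℰ.ExtVanish V K := by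
  intro e
  obtain ⟨N, n, q, hN⟩ := ℰ.exists_realizes (push ℰ.E k e)
  obtain ⟨g', hg'⟩ := hN.exists_extend g (by rw [← push_comp, h.comp_eq_zero, push_zero_hom])
  -- Since `N` lies in `𝒟`, the extension `g'` of `g` factors through `g`. By minimality `n ≫ t` is
  -- invertible, so the pushed extension splits.
  obtain ⟨t, ht⟩ := hg.2 N g' (hext V N hV hN.tri)
  have := hmin (n ≫ t) (by rw [Category.assoc, ht, hg'])
  have h0 : push ℰ.E k e = 0 := by
    rw [← push_id ℰ.E (push ℰ.E k e), ← IsIso.hom_inv_id (n ≫ t), push_comp, push_comp,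
      hN.push_eq_zero, push_zero, push_zero]
  obtain ⟨c, rfl⟩ := h.exists_pull_eq e h0
  obtain ⟨b, rfl⟩ := hg.2 V c hV
  exact h.pull_eq_zero_of_lift b

section Minimal

variable {𝒟 𝒴 : ObjectProperty C} {X : C}

theorem _root_.Extri.IsRightApprox.of_iso {W W' : C} (h𝒟 : IsSubcategory 𝒟) {g : W ⟶ X}
    (hg : IsRightApprox 𝒟 g) (e : W' ≅ W) : IsRightApprox 𝒟 (e.hom ≫ g) :=
  ⟨h𝒟.iso e.symm hg.1, fun V g' hV => by
    obtain ⟨t, ht⟩ := hg.2 V g' hV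
    exact ⟨t ≫ e.inv, by simpa using ht⟩⟩

/-- A zero summand of an approximation can be removed. -/
theorem exists_conflation_of_biprod (hWIC : ℰ.WIC) (h𝒟 : IsSubcategory 𝒟)
    (h𝒴 : IsSubcategory 𝒴) {K A W : C} {k : K ⟶ A ⊞ W} {g : A ⊞ W ⟶ X}
    (h : ℰ.IsConflation k g) (hK : 𝒴 K) (hg : IsRightApprox 𝒟 g) (h0 : biprod.inl ≫ g = 0) :
    ∃ (K' : C) (k' : K' ⟶ W),
      ℰ.IsConflation k' (biprod.inr ≫ g) ∧ 𝒴 K' ∧ IsRightApprox 𝒟 (biprod.inr ≫ g) := by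
  have hgg : g = biprod.snd ≫ biprod.inr ≫ g := by
    apply biprod.hom_ext' <;> simp [h0]
  obtain ⟨K', k', δ', h'⟩ := hWIC.deflation (biprod.snd : A ⊞ W ⟶ W) (biprod.inr ≫ g)
    (by rw [← hgg]; exact ⟨K, k, h⟩)
  obtain ⟨Z, _, _, _, _, -, -, h1, h2, -, -⟩ := ℰ.et4_op (ℰ.realizes_zero A W) h'
  rw [pull_zero] at h2
  obtain ⟨e⟩ := h2.iso_of_eq (ℰ.realizes_zero A K')
  rw [← hgg] at h1
  obtain ⟨δ, h⟩ := h
  obtain ⟨e'⟩ := h.kernel_iso h1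
  refine ⟨K', k', ⟨δ', h'⟩, h𝒴.right (e' ≪≫ e) hK, h𝒟.right (Iso.refl _) hg.1, ?_⟩
  intro V v hV
  obtain ⟨t, ht⟩ := hg.2 V v hV
  exact ⟨t ≫ biprod.snd, by rw [Category.assoc, ← hgg, ht]⟩

/-- In a Krull--Schmidt category, approximations can be chosen right minimal. -/
theorem exists_minimal_approx (hKS : IsKrullSchmidt C) (hWIC : ℰ.WIC) (h𝒟 : IsSubcategory 𝒟)
    (h𝒴 : IsSubcategory 𝒴) {K W : C} {k : K ⟶ W} {g : W ⟶ X}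
    (h : ℰ.IsConflation k g) (hK : 𝒴 K) (hg : IsRightApprox 𝒟 g) :
    ∃ (K' W' : C) (k' : K' ⟶ W') (g' : W' ⟶ X), ℰ.IsConflation k' g' ∧ 𝒴 K' ∧
      IsRightApprox 𝒟 g' ∧ ∀ t : W' ⟶ W', t ≫ g' = g' → IsIso t := by
  -- Right minimality is obtained by minimizing the number of local summands of the approximation.
  let Q : ℕ → Prop := fun n => ∃ (f : Fin n → C) (K : C) (k : K ⟶ ⨁ f) (g : (⨁ f) ⟶ X),
    (∀ i, IsLocalRing (End (f i))) ∧ ℰ.IsConflation k g ∧ 𝒴 K ∧ IsRightApprox 𝒟 g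
  have hQ : ∃ n, Q n := by
    obtain ⟨n, f, hf, ⟨e⟩⟩ := hKS W
    refine ⟨n, f, K, _, _, hf, h.of_iso (Iso.refl _) e (Iso.refl _), hK, ?_⟩
    simpa using hg.of_iso h𝒟 e.symm
  classical
  obtain ⟨f, K', k', g', hf, h', hK', hg'⟩ := Nat.find_spec hQ
  have hmin : ∀ m, Q m → Nat.find hQ ≤ m := fun m hm => Nat.find_min' hQ hm
  generalize Nat.find hQ = n at f k' g' hf h' hg' hmin
  refine ⟨K', _, k', g', h', hK', hg', fun t ht => ?_⟩
  by_contra hiso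
  -- If `t` is not invertible, `𝟙 - t` is not radical, so it has an invertible entry. Its image is
  -- killed by `g'`, so a copy of `f i` replacing `f j` is a summand that can be removed.
  obtain ⟨i, j, hij⟩ : ∃ i j, IsIso (biproduct.ι f i ≫ (𝟙 _ - t) ≫ biproduct.π f j) := by
    by_contra! hne
    apply hiso
    have := isIso_id_sub_of_forall_not_isIso f hf (𝟙 _ - t) hne
    simpa using this
  obtain ⟨m, rfl⟩ : ∃ m, n = m + 1 := ⟨n - 1, by have := i.isLt; lia⟩
  obtain ⟨s, hs⟩ := exists_iso_biprod_of_isIso (biproductSuccAboveIso f j)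
    (biproduct.ι f i ≫ (𝟙 _ - t)) (by simpa [biproductSuccAboveIso] using hij)
  have h0 : biprod.inl ≫ s.hom ≫ g' = 0 := by
    rw [reassoc_of% hs, Preadditive.sub_comp, ht]; simp
  have h1 := h'.of_iso (Iso.refl _) s.symm (Iso.refl _)
  simp only [Iso.symm_inv, Iso.refl_hom, Category.comp_id] at h1
  obtain ⟨K'', k'', h2, hK'', hg''⟩ := exists_conflation_of_biprod hWIC h𝒟 h𝒴 h1 hK'
    (hg'.of_iso h𝒟 s) h0
  have := hmin m ⟨_, K'', k'', _, fun l => hf _, h2, hK'', hg''⟩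
  lia

end Minimal

end ExtriangulatedStructure

end Extri

/-! ### From resolving subcategories to tilting subcategories -/

namespace Extri

theorem IsSubcategory.of_biproduct {C : Type u} [Category.{v} C] [Preadditive C]
    [HasFiniteBiproducts C] {ω : ObjectProperty C} (hω : IsSubcategory ω) {n : ℕ} {f : Fin n → C}
    (h : ω (⨁ f)) (i : Fin n) : ω (f i) := by
  obtain ⟨m, rfl⟩ : ∃ m, n = m + 1 := ⟨n - 1, by have := i.isLt; lia⟩
  exact hω.left (biproductSuccAboveIso f i) h

namespace ExtriangulatedStructure

variable {C : Type u} [Category.{v} C] [Preadditive C] [HasFiniteBiproducts C]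
variable {ℰ : ExtriangulatedStructure.{w} C}

theorem IsRelResolving.exists_tri_approx {𝒟 𝒴 : ObjectProperty C} (hKS : IsKrullSchmidt C)
    (hWIC : ℰ.WIC) (h𝒟 : IsSubcategory 𝒟) (h𝒴 : IsSubcategory 𝒴)
    (h𝒴ext : ∀ {A B X : C}, ℰ.Tri A B X → 𝒴 A → 𝒴 X → 𝒴 B) (h : ℰ.IsRelResolving 𝒟 𝒴)
    (hcf : ℰ.StronglyContravariantlyFiniteIn 𝒟 𝒴) {X : C} (hX : 𝒴 X) :
    ∃ K W, ℰ.Tri K W X ∧ 𝒟 W ∧ 𝒴 K ∧ ∀ V, 𝒟 V → ℰ.ExtVanish V K := by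
  obtain ⟨K, W, k, g, h1, hg⟩ := hcf X hX
  obtain ⟨K', W', k', g', h2, hK', hg', hmin⟩ :=
    exists_minimal_approx hKS hWIC h𝒟 h𝒴 h1.2.2.2 h1.1 hg
  refine ⟨K', W', h2.tri, hg'.1, hK', fun V hV => ?_⟩
  obtain ⟨δ, h2⟩ := h2
  refine h2.extVanish_of_minimal hg' hmin (fun V N hV hN => ?_) hV
  have hN' := h𝒴ext hN (h.le _ hg'.1) (h.le _ hV)
  obtain ⟨x, y, hxy⟩ := hN
  exact h.extension x y ⟨h.le _ hg'.1, hN', h.le _ hV, hxy⟩ hg'.1 hV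

variable [ℰ.EnoughProj]

theorem isSubcategory_rightPerp (ω : ObjectProperty C) : IsSubcategory (ℰ.rightPerp ω) where
  zero _ hZ X _ i := Orth.of_isZero_right hZ X i
  iso e h := rightPerp.of_retract h e.inv e.hom (by simp)
  sum {X Y} hX hY := (ℰ.tri_split X Y).rightPerp hX hY
  summand h := rightPerp.of_retract h biprod.inl biprod.fst (by simp)

variable (ℰ) in
/-- A relative resolving subcategory `𝒟` of `_𝒞𝒳` with special approximations and relative
injective coapproximations, contained in `𝒞̂`. -/
structure IsSpecialResolving (𝒞 𝒟 : ObjectProperty C) : Prop where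
  isSubcategory_left : IsSubcategory 𝒞
  selfOrthogonal : ℰ.SelfOrthogonal 𝒞
  isSubcategory_right : IsSubcategory 𝒟
  resolving : ℰ.IsRelResolving 𝒟 (ℰ.properRes 𝒞)
  approx : ∀ X, ℰ.properRes 𝒞 X →
    ∃ K W, ℰ.Tri K W X ∧ 𝒟 W ∧ ℰ.properRes 𝒞 K ∧ ∀ V, 𝒟 V → ℰ.ExtVanish V K
  cogenerator : ∃ ℐ : ObjectProperty C, ℰ.IsRelInjCogenerator ℐ (ℰ.properRes 𝒞)
  le_hat : 𝒟 ≤ ℰ.hat 𝒞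

variable (ℰ) in
/-- The objects of `_𝒞𝒳` right orthogonal to `𝒟`. -/
abbrev relPerp (𝒞 𝒟 : ObjectProperty C) : ObjectProperty C := ℰ.properRes 𝒞 ⊓ ℰ.rightPerp 𝒟

variable (ℰ) in
/-- The `Ext`-injective objects of `𝒟`. -/
abbrev extInj (𝒟 : ObjectProperty C) : ObjectProperty C := 𝒟 ⊓ ℰ.rightPerp 𝒟

namespace IsSpecialResolving

variable {𝒞 𝒟 : ObjectProperty C}

theorem left_le (h : ℰ.IsSpecialResolving 𝒞 𝒟) : 𝒞 ≤ 𝒟 :=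
  (le_projIn_properRes h.isSubcategory_left h.selfOrthogonal).trans h.resolving.proj_le

theorem cocone (h : ℰ.IsSpecialResolving 𝒞 𝒟) {A B X : C} (hT : ℰ.Tri A B X)
    (hA : ℰ.properRes 𝒞 A) (hB : 𝒟 B) (hX : 𝒟 X) : 𝒟 A := by
  obtain ⟨x, y, hxy⟩ := hT
  exact h.resolving.cocone x y ⟨hA, h.resolving.le _ hB, h.resolving.le _ hX, hxy⟩ hB hX

theorem relPerp_extension (h : ℰ.IsSpecialResolving 𝒞 𝒟) {A B X : C} (hT : ℰ.Tri A B X)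
    (hA : ℰ.relPerp 𝒞 𝒟 A) (hX : ℰ.relPerp 𝒞 𝒟 X) : ℰ.relPerp 𝒞 𝒟 B :=
  ⟨hT.properRes h.isSubcategory_left hA.1 hX.1, hT.rightPerp hA.2 hX.2⟩

theorem isSubcategory_extInj (h : ℰ.IsSpecialResolving 𝒞 𝒟) : IsSubcategory (ℰ.extInj 𝒟) :=
  isSubcategory_inf h.isSubcategory_right (isSubcategory_rightPerp 𝒟)

theorem selfOrthogonal_extInj (𝒟 : ObjectProperty C) : ℰ.SelfOrthogonal (ℰ.extInj 𝒟) :=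
  fun _ hX V hV => hX.2 V hV.1

theorem isTilting_extInj (h : ℰ.IsSpecialResolving 𝒞 𝒟)
    (hle : 𝒟 ≤ ℰ.check (ℰ.extInj 𝒟)) : ℰ.IsTilting 𝒞 (ℰ.extInj 𝒟) where
  selfOrthogonal_left := h.selfOrthogonal
  selfOrthogonal_right := selfOrthogonal_extInj 𝒟
  le_hat := inf_le_left.trans h.le_hat
  le_check := h.left_le.trans hle

variable [ℰ.EnoughInj]

/-- Shift dimension along `𝒞`-syzygies of `V`, which stay in `𝒟` because `𝒟` is resolving. -/
theorem rightPerp_of_extVanish (h : ℰ.IsSpecialResolving 𝒞 𝒟) {Y : C} (hY : ℰ.properRes 𝒞 Y)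
    (hvan : ∀ V, 𝒟 V → ℰ.ExtVanish V Y) : ℰ.rightPerp 𝒟 Y := by
  intro V hV i
  induction i generalizing V with
  | zero => exact hvan V hV
  | succ i ih =>
    obtain ⟨K, W, hK, hW, h1⟩ := (h.resolving.le V hV).exists_tri
    exact h1.higherVanish_cone_left (ih K (h.cocone h1 hK (h.left_le W hW) hV))
      (properRes_le Y hY W hW (i + 1))

theorem exists_tri (h : ℰ.IsSpecialResolving 𝒞 𝒟) {X : C} (hX : ℰ.properRes 𝒞 X) :
    ∃ K W, ℰ.Tri K W X ∧ 𝒟 W ∧ ℰ.relPerp 𝒞 𝒟 K := by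
  obtain ⟨K, W, h1, hW, hK, hvan⟩ := h.approx X hX
  exact ⟨K, W, h1, hW, hK, h.rightPerp_of_extVanish hK hvan⟩

/-- Salce's trick: embed `X` into a relative injective and pull back along the special approximation
of the cokernel. -/
theorem exists_tri_relPerp (h : ℰ.IsSpecialResolving 𝒞 𝒟) {X : C} (hX : ℰ.properRes 𝒞 X) :
    ∃ B W, ℰ.Tri X B W ∧ ℰ.relPerp 𝒞 𝒟 B ∧ 𝒟 W := by
  obtain ⟨ℐ, hℐ⟩ := h.cogenerator
  obtain ⟨I, Y', x, y, hI, hY', h1⟩ := hℐ.exists_conflation X hX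
  obtain ⟨K, W, h2, hW, hK⟩ := h.exists_tri hY'
  obtain ⟨M, h3, h4⟩ := h1.tri.pullback h2
  exact ⟨M, W, h4, h.relPerp_extension h3 hK
    ⟨hℐ.le I hI, fun V hV => hℐ.le_perp I hI V (h.resolving.le V hV)⟩, hW⟩

theorem exists_tri_extInj (h : ℰ.IsSpecialResolving 𝒞 𝒟) {X : C} (hX : 𝒟 X) :
    ∃ T W, ℰ.Tri X T W ∧ ℰ.extInj 𝒟 T ∧ 𝒟 W := by
  obtain ⟨T, W, h1, hT, hW⟩ := h.exists_tri_relPerp (h.resolving.le X hX)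
  have hT' := hT.1
  refine ⟨T, W, h1, ⟨?_, hT.2⟩, hW⟩
  obtain ⟨x, y, hxy⟩ := h1
  exact h.resolving.extension x y ⟨h.resolving.le X hX, hT', h.resolving.le W hW, hxy⟩ hX hW

theorem exists_tri_check (h : ℰ.IsSpecialResolving 𝒞 𝒟) {S : C}
    (hS : ℰ.check (ℰ.properRes 𝒞) S) :
    ∃ K Z, ℰ.Tri K Z S ∧ ℰ.relPerp 𝒞 𝒟 K ∧ ℰ.check 𝒟 Z := by
  obtain ⟨n, hS⟩ := hS
  induction n generalizing S with
  | zero =>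
    obtain ⟨K, W, h1, hW, hK⟩ := h.exists_tri hS
    exact ⟨K, W, h1, hK, check_of_mem hW⟩
  | succ n ih =>
    obtain ⟨Y, S', _, _, hY, hS', h1⟩ := hS
    obtain ⟨K', Z', h2, hK', hZ'⟩ := ih hS'
    obtain ⟨M, h3, h4⟩ := h1.tri.pullback h2
    obtain ⟨K, W, h5, hW, hK⟩ := h.exists_tri (h3.properRes h.isSubcategory_left hK'.1 hY)
    obtain ⟨Z, h6, h7⟩ := h5.comp_deflation h4
    exact ⟨K, Z, h7, hK, check.intro h6 hW hZ'⟩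

/-- `P` is left abstract for two uses: bounding the relative dimension, and embedding into `add` of
one fixed object. -/
theorem exists_tri_of_hasFiltration (h : ℰ.IsSpecialResolving 𝒞 𝒟) {P : ObjectProperty C}
    (hzero : ∀ Z, IsZero Z → P Z) (hext : ∀ {A B X : C}, ℰ.Tri A B X → P A → P X → P B)
    (hvan : ∀ Z K, P Z → ℰ.relPerp 𝒞 𝒟 K → ℰ.HigherVanish 1 Z K) {S : Set C}
    (hS : ∀ s ∈ S, ∃ K Z, ℰ.Tri K Z s ∧ ℰ.relPerp 𝒞 𝒟 K ∧ P Z) {M : C}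
    (hM : ℰ.HasFiltration S M) : ∃ K Z, ℰ.Tri K Z M ∧ ℰ.relPerp 𝒞 𝒟 K ∧ P Z := by
  induction hM with
  | zero hZ =>
    exact ⟨_, _, ℰ.tri_zero_id _ hZ, ⟨properRes_isZero h.isSubcategory_left h.selfOrthogonal hZ,
      (isSubcategory_rightPerp 𝒟).zero _ hZ⟩, hzero _ hZ⟩
  | step x y _ hs hxy ih =>
    obtain ⟨K, Z, h1, hK, hZ⟩ := ih
    obtain ⟨K', Z', h2, hK', hZ'⟩ := hS _ hs
    obtain ⟨N, h3, h4⟩ := hxy.tri.pullback h2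
    obtain ⟨N', h5, h6⟩ := h1.exists_lift_extension h4 (hvan Z' K hZ' hK)
    obtain ⟨L, h7, h8⟩ := h6.comp_deflation h3
    exact ⟨L, N', h7, h.relPerp_extension h8 hK hK', hext h5 hZ hZ'⟩

theorem exists_relDimLE (h : ℰ.IsSpecialResolving 𝒞 𝒟)
    (hfilt : ℰ.FinitelyFiltered (ℰ.check (ℰ.properRes 𝒞))) :
    ∃ n, 𝒟 ≤ ℰ.relDimLE (ℰ.properRes 𝒞) n := by
  obtain ⟨S, hfin, hS, hfilt⟩ := hfilt
  have hex : ∀ s, ∃ n, s ∈ S → ∃ K Z, ℰ.Tri K Z s ∧ ℰ.relPerp 𝒞 𝒟 K ∧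
      (∀ Y, ℰ.rightPerp 𝒟 Y → ℰ.Orth Z Y) ∧ ℰ.relDimLE (ℰ.properRes 𝒞) n Z := by
    intro s
    by_cases hs : s ∈ S
    · obtain ⟨K, Z, h1, hK, hZ⟩ := h.exists_tri_check (hS s hs)
      obtain ⟨n, hn⟩ := exists_relDimLE_of_check
        (fun A hA => exists_relDimLE_of_hat (h.le_hat A hA)) hZ
      exact ⟨n, fun _ => ⟨K, Z, h1, hK, fun Y hY => hZ.orth hY, hn⟩⟩
    -- The default bound outside `S` makes the chosen `g` a total function.
    · exact ⟨0, fun hs' => absurd hs' hs⟩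
  choose g hg using hex
  obtain ⟨n, hn⟩ := (hfin.image g).bddAbove
  refine ⟨n, fun X hX => ?_⟩
  obtain ⟨K, Z, h1, hK, hZ⟩ := h.exists_tri_of_hasFiltration
    (P := fun Z => (∀ Y, ℰ.rightPerp 𝒟 Y → ℰ.Orth Z Y) ∧ ℰ.relDimLE (ℰ.properRes 𝒞) n Z)
    (fun Z hZ => ⟨fun Y _ => Orth.of_isZero_left hZ Y, (isSubcategory_relDimLE _ n).zero Z hZ⟩)
    (fun hT hA hX => ⟨fun Y hY => hT.orth_left (hA.1 Y hY) (hX.1 Y hY), hT.relDimLE hA.2 hX.2⟩)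
    (fun Z K hZ hK => hZ.1 K hK.2 1)
    (fun s hs => by
      obtain ⟨K, Z, h1, hK, hZ, hZ'⟩ := hg s hs
      exact ⟨K, Z, h1, hK, hZ, hZ'.mono (hn ⟨s, hs, rfl⟩)⟩)
    (hfilt X (check_of_mem (h.resolving.le X hX)))
  -- The conflation splits over an object of `𝒟`, so `X` inherits the bound as a summand of `Z`.
  obtain ⟨e⟩ := h1.iso_biprod (hK.2 X hX 0)
  exact (isSubcategory_relDimLE _ n).right e hZ.2

/-- Each cokernel of an embedding into an Ext-injective has one degree fewer of nonvanishing
extensions from `𝒟`; when none remain, it is itself Ext-injective. -/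
theorem le_check_extInj (h : ℰ.IsSpecialResolving 𝒞 𝒟) {n : ℕ}
    (hn : 𝒟 ≤ ℰ.relDimLE (ℰ.properRes 𝒞) n) : 𝒟 ≤ ℰ.check (ℰ.extInj 𝒟) := by
  have key : ∀ (k : ℕ) (X : C), 𝒟 X → (∀ V, 𝒟 V → ∀ i, k ≤ i → ℰ.HigherVanish i V X) →
      ℰ.check (ℰ.extInj 𝒟) X := by
    intro k
    induction k with
    | zero => exact fun X hX hvan => check_of_mem ⟨hX, fun V hV i => hvan V hV i (Nat.zero_le i)⟩
    | succ k ih =>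
      intro X hX hvan
      obtain ⟨T, W, h1, hT, hW⟩ := h.exists_tri_extInj hX
      exact check.intro h1 hT (ih W hW fun V hV i hi =>
        h1.higherVanish_cone_right (hT.2 V hV i) (hvan V hV (i + 1) (by lia)))
  exact fun X hX => key n X hX fun V hV i hi => hn V hV X (h.resolving.le X hX) i hi

theorem check_le_check_extInj (h : ℰ.IsSpecialResolving 𝒞 𝒟)
    (hle : 𝒟 ≤ ℰ.check (ℰ.extInj 𝒟)) : ℰ.check 𝒟 ≤ ℰ.check (ℰ.extInj 𝒟) := by
  rintro X ⟨n, hX⟩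
  induction n generalizing X with
  | zero => exact hle X hX
  | succ n ih =>
    obtain ⟨W, K, _, _, hW, hK, h1⟩ := hX
    exact h1.tri.check_cocone h.isSubcategory_extInj (selfOrthogonal_extInj 𝒟) (hle W hW) (ih K hK)

/-- All cosyzygies stay in `properRes 𝒞`, so closure under cocones descends from the last term back
to `X`. -/
theorem check_extInj_inf_le (h : ℰ.IsSpecialResolving 𝒞 𝒟) :
    ℰ.check (ℰ.extInj 𝒟) ⊓ ℰ.properRes 𝒞 ≤ 𝒟 := by
  rintro X ⟨⟨n, hX⟩, hX'⟩
  induction n generalizing X with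
  | zero => exact hX.1
  | succ n ih =>
    obtain ⟨T, K, _, _, hT, hK, h1⟩ := hX
    exact h.cocone h1.tri hX' hT.1 (ih K
      (h1.tri.properRes_cone h.isSubcategory_left hX' (h.resolving.le T hT.1)) hK)

theorem isFiniteSubcategory_extInj (h : ℰ.IsSpecialResolving 𝒞 𝒟)
    (hle : 𝒟 ≤ ℰ.check (ℰ.extInj 𝒟))
    (hfilt : ℰ.FinitelyFiltered (ℰ.check (ℰ.properRes 𝒞))) :
    IsFiniteSubcategory (ℰ.extInj 𝒟) := by
  obtain ⟨S, hfin, hS, hfilt⟩ := hfilt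
  obtain ⟨m, f, -, rfl⟩ := hfin.fin_param
  have hsub := h.isSubcategory_extInj
  have hself := selfOrthogonal_extInj (ℰ := ℰ) 𝒟
  have hex : ∀ i, ∃ K Z T Z', ℰ.Tri K Z (f i) ∧ ℰ.relPerp 𝒞 𝒟 K ∧
      ℰ.check (ℰ.extInj 𝒟) Z ∧ ℰ.Tri Z T Z' ∧ ℰ.extInj 𝒟 T ∧ ℰ.check (ℰ.extInj 𝒟) Z' := by
    intro i
    obtain ⟨K, Z, h1, hK, hZ⟩ := h.exists_tri_check (hS (f i) ⟨i, rfl⟩)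
    have hZ' := h.check_le_check_extInj hle Z hZ
    obtain ⟨T, Z', hT, hZ'', h2⟩ := hZ'.exists_tri hsub
    exact ⟨K, Z, T, Z', h1, hK, hZ', h2, hT, hZ''⟩
  choose K Z T Z' h1 hK hZ h2 hT hZ' using hex
  have hadd : add (⨁ T) ≤ ℰ.extInj 𝒟 := hsub.add_le (hsub.biproduct T hT)
  refine ⟨⨁ T, le_antisymm (fun X hX => ?_) hadd⟩
  have hadd' := isSubcategory_add (⨁ T)
  obtain ⟨L, M, h3, hL, hM, T', M', hT', hM', h4⟩ := h.exists_tri_of_hasFiltration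
    (P := fun M => ℰ.check (ℰ.extInj 𝒟) M ∧ ∃ T' M', add (⨁ T) T' ∧
      ℰ.check (ℰ.extInj 𝒟) M' ∧ ℰ.Tri M T' M')
    (fun M hM => ⟨check_of_mem (hsub.zero M hM), M, M, hadd'.zero M hM,
      check_of_mem (hsub.zero M hM), ℰ.tri_id_zero M hM⟩)
    (fun hABX hA hX => by
      obtain ⟨hA, T₁, M₁, hT₁, hM₁, h5⟩ := hA
      obtain ⟨hX, T₂, M₂, hT₂, hM₂, h6⟩ := hX
      obtain ⟨M₃, h7, h8⟩ := hABX.horseshoe_right h5 h6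
        (hX.orth (hself T₁ (hadd T₁ hT₁))).extVanish
      exact ⟨hABX.check hsub hself hA hX, T₁ ⊞ T₂, M₃, hadd'.sum hT₁ hT₂,
        h7.check hsub hself hM₁ hM₂, h8⟩)
    (fun M L hM hL => hM.1.orth (fun V hV => hL.2 V hV.1) 1)
    (by
      rintro _ ⟨i, rfl⟩
      exact ⟨K i, Z i, h1 i, hK i, hZ i, T i, Z' i, hadd'.of_biproduct (self_mem_add _) i,
        hZ' i, h2 i⟩)
    (hfilt X (check_of_mem (h.resolving.le X hX.1)))
  obtain ⟨e⟩ := h3.iso_biprod (hL.2 X hX.1 0)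
  -- `X` is a summand of `M`, which embeds in `T'`. The cokernel `Q` of `X → M → T'` is an extension
  -- of `M'` by `L`, so `E(Q, X) = 0` and `X` is a summand of `T'`.
  obtain ⟨Q, h5, h6⟩ := ((ℰ.tri_split X L).of_iso (Iso.refl _)
    (biprod.braiding X L ≪≫ e.symm) (Iso.refl _)).comp_inflation h4
  have hLX : ℰ.Orth L X := ((hM.orth (hself X hX)).of_iso_left e).of_biprod_left
  obtain ⟨e'⟩ := h5.iso_biprod (h6.orth_left hLX (hM'.orth (hself X hX))).extVanish
  exact hadd'.left e' hT'

end IsSpecialResolving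

end ExtriangulatedStructure

end Extri

theorem mainTheorem3 {C : Type u} [Category.{v} C] [Preadditive C] [HasFiniteBiproducts C]
    (ℰ : Extri.ExtriangulatedStructure.{w} C)
    (hKS : Extri.IsKrullSchmidt C) [ℰ.EnoughProj] [ℰ.EnoughInj] (hWIC : ℰ.WIC)
    (𝒞 : ObjectProperty C) (h𝒞 : Extri.IsSubcategory 𝒞) (hself : ℰ.SelfOrthogonal 𝒞)
    (hcogen : ∃ ℐ : ObjectProperty C, ℰ.IsRelInjCogenerator ℐ (ℰ.properRes 𝒞))
    (hfilt : ℰ.FinitelyFiltered (ℰ.check (ℰ.properRes 𝒞))) :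
    Set.BijOn (fun 𝒯 : ObjectProperty C => ℰ.check 𝒯 ⊓ ℰ.properRes 𝒞)
      {𝒯 | Extri.IsSubcategory 𝒯 ∧ Extri.IsFiniteSubcategory 𝒯 ∧ ℰ.IsTilting 𝒞 𝒯}
      {𝒟 | Extri.IsSubcategory 𝒟 ∧ ℰ.IsRelResolving 𝒟 (ℰ.properRes 𝒞) ∧
        ℰ.StronglyContravariantlyFiniteIn 𝒟 (ℰ.properRes 𝒞) ∧ 𝒟 ≤ ℰ.hat 𝒞} := by
  refine ⟨?_, ?_, ?_⟩
  · rintro 𝒯 ⟨h𝒯, hfin, h⟩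
    exact ⟨Extri.ExtriangulatedStructure.isSubcategory_inf
      (Extri.ExtriangulatedStructure.isSubcategory_check h𝒯 h.selfOrthogonal_right)
      (Extri.ExtriangulatedStructure.isSubcategory_properRes h𝒞 hself),
      h.isRelResolving h𝒞 h𝒯, h.stronglyContravariantlyFiniteIn h𝒞 h𝒯 hfin,
      h.check_inf_properRes_le_hat h𝒞⟩
  · rintro 𝒯 ⟨h𝒯, -, h⟩ 𝒯' ⟨h𝒯', -, h'⟩ heq
    dsimp only at heq
    funext X
    rw [eq_iff_iff, h.mem_iff h𝒞 h𝒯, h'.mem_iff h𝒞 h𝒯', heq]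
  · rintro 𝒟 ⟨h𝒟, hres, hcf, hhat⟩
    have h : ℰ.IsSpecialResolving 𝒞 𝒟 := ⟨h𝒞, hself, h𝒟, hres, fun X hX =>
      hres.exists_tri_approx hKS hWIC h𝒟
        (Extri.ExtriangulatedStructure.isSubcategory_properRes h𝒞 hself)
        (fun hT => hT.properRes h𝒞) hcf hX, hcogen, hhat⟩
    obtain ⟨n, hn⟩ := h.exists_relDimLE hfilt
    have hle := h.le_check_extInj hn
    exact ⟨ℰ.extInj 𝒟, ⟨h.isSubcategory_extInj, h.isFiniteSubcategory_extInj hle hfilt,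
      h.isTilting_extInj hle⟩, le_antisymm h.check_extInj_inf_le
      (le_inf hle hres.le)⟩
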